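/- Let $V\subset\mathbb{R}^2$ be a finite set of points, not all on one line, and let $s$ be a real-valued function that is convex on $\operatorname{conv}V$. Put $s_v=s(v)$. A triangulation of $V$ is a simplicial complex in the plane whose vertex set is exactly $V$ and whose underlying space is $\operatorname{conv}V$. A hinge $(i,j;k,l)$ of a planar simplicial complex consists of two different triangles $ijk$ and $ijl$ of the complex that share the edge $ij$; edges having a hinge are called interior edges. The conductivity of an interior edge $ij$ with hinge $(i,j;k,l)$ is given by the hinge formula $$q_{ij}=-\frac{\cot\theta_{ijk}+\cot\theta_{ijl}}{|e_{ij}|^2}\,s_i-\frac{\cot\theta_{jik}+\cot\theta_{jil}}{|e_{ij}|^2}\,s_j+\frac{1}{2|t_{ijk}|}\,s_k+\frac{1}{2|t_{ijl}|}\,s_l ,$$ where $|e_{ij}|$ is the length of the edge, $|t_{abc}|$ the area of the triangle $abc$ and $\theta_{abc}$ its interior angle at $b$. A complex is called $Q$-adapted if $q_{ij}\ge 0$ for all of its interior edges $ij$. The lower hull of the lifted points is the set of points $(x,z)$ of $C=\operatorname{conv}\{(v,s_v):v\in V\}\subset\mathbb{R}^3$ such that no $(x,z')\in C$ has $z'<z$;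 a complex with vertices in $V$ is called a projection of the lower hull if the union of its lifted simplices $\operatorname{conv}\{(v,s_v): v \text{ a vertex of the simplex}\}$ is the lower hull. Then: 1. There is a triangulation of $V$ that is a projection of the lower hull and is $Q$-adapted. 2. Every simplicial complex with vertices in $V$ that is a projection of the lower hull is $Q$-adapted. 3. For every hinge $(i,j;k,l)$ of a planar simplicial complex, $q_{ij}>0$ if and only if the lifted hinge is convex (some plane through $(i,s_i)$ and $(j,s_j)$ passes strictly below $(k,s_k)$ and $(l,s_l)$), and $q_{ij}=0$ if and only if the lifted hinge is flat (the four lifted points lie on one non-vertical plane). 4. If $K$ is a $Q$-adapted triangulation of $V$ with $q_{ij}\ne 0$ for all interior edges $ij$, then $K$ is the only $Q$-adapted triangulation of $V$. -/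

import Mathlib

namespace QAdapted

/-- The Euclidean plane. -/
abbrev Plane : Type := EuclideanSpace ℝ (Fin 2)

/-- A planar simplicial complex. -/
abbrev PlaneComplex : Type := Geometry.SimplicialComplex ℝ Plane

/-- `K` is a triangulation of the finite point set `V`: a simplicial complex whose vertices are
exactly the points of `V` and which tessellates the convex hull of `V`. -/
structure IsTriangulation (V : Finset Plane) (K : PlaneComplex) : Prop where
  vertices_eq : K.vertices = (V : Set Plane)
  space_eq : K.space = convexHull ℝ (V : Set Plane)

/-- `a`, `b`, `c` are the three distinct corners of a triangle (a two-dimensional face) of `K`. -/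
structure IsTriangle (K : PlaneComplex) (a b c : Plane) : Prop where
  ne_ab : a ≠ b
  ne_bc : b ≠ c
  ne_ac : a ≠ c
  face : ∃ t ∈ K.faces, (t : Set Plane) = {a, b, c}

/-- `i j` is an interior edge of `K`, that is, an edge with a complete hinge: `i j k` and `i j l`
are two different triangles of `K` that share the edge `i j`. -/
structure IsHinge (K : PlaneComplex) (i j k l : Plane) : Prop where
  left : IsTriangle K i j k
  right : IsTriangle K i j l
  ne : k ≠ l

/-- The (unsigned) area of the triangle with corners `a`, `b`, `c`. -/
noncomputable def triangleArea (a b c : Plane) : ℝ :=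
  |(b 0 - a 0) * (c 1 - a 1) - (b 1 - a 1) * (c 0 - a 0)| / 2

/-- The hinge formula: the conductivity `q_ij` of the edge `i j` with incident triangles `i j k`
and `i j l`, computed from the values of `s` at the nodes. The angle `θ_ijk` is the interior angle
of the triangle `i j k` at the vertex `j`, which is `EuclideanGeometry.angle i j k`. -/
noncomputable def hingeConductivity (s : Plane → ℝ) (i j k l : Plane) : ℝ :=
  - (1 / dist i j ^ 2) *
      (Real.cot (EuclideanGeometry.angle i j k) + Real.cot (EuclideanGeometry.angle i j l)) * s i
  - (1 / dist i j ^ 2) *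
      (Real.cot (EuclideanGeometry.angle j i k) + Real.cot (EuclideanGeometry.angle j i l)) * s j
  + 1 / (2 * triangleArea i j k) * s k
  + 1 / (2 * triangleArea i j l) * s l

/-- The lifted hinge is (strictly) convex along the edge `i j`: some plane through the two lifted
points over `i` and `j` passes strictly below the lifted points over `k` and `l`. -/
def HingeConvex (s : Plane → ℝ) (i j k l : Plane) : Prop :=
  ∃ f : Plane →ᵃ[ℝ] ℝ, f i = s i ∧ f j = s j ∧ f k < s k ∧ f l < s l

/-- The lifted hinge is flat: the four lifted points lie on one (non-vertical) plane. -/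
def HingeFlat (s : Plane → ℝ) (i j k l : Plane) : Prop :=
  ∃ f : Plane →ᵃ[ℝ] ℝ, f i = s i ∧ f j = s j ∧ f k = s k ∧ f l = s l

/-- `K` is `Q`-adapted (`Q` being the rotated Hessian of `s`): all edge conductivities given by the
hinge formula on the interior edges of `K` are non-negative. -/
def IsQAdapted (s : Plane → ℝ) (K : PlaneComplex) : Prop :=
  ∀ i j k l : Plane, IsHinge K i j k l → 0 ≤ hingeConductivity s i j k l

/-- Projection of a planar point up to the graph of `s`. -/
def lift (s : Plane → ℝ) (x : Plane) : Plane × ℝ := (x, s x)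

/-- The lower part of the boundary of the convex hull of the lifted points of `V`. -/
def lowerHull (s : Plane → ℝ) (V : Finset Plane) : Set (Plane × ℝ) :=
  {p | p ∈ convexHull ℝ (lift s '' (V : Set Plane)) ∧
    ∀ z : ℝ, (p.1, z) ∈ convexHull ℝ (lift s '' (V : Set Plane)) → p.2 ≤ z}

/-- `K` is obtained by triangulating the lower convex hull of the lifted points of `V` and
projecting back to the plane: its vertices are points of `V`, and its lifted simplices make up
the lower hull. -/
structure IsLowerHullProjection (s : Plane → ℝ) (V : Finset Plane) (K : PlaneComplex) : Prop where
  vertices_subset : K.vertices ⊆ (V : Set Plane)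
  lift_eq : ⋃ t ∈ K.faces, convexHull ℝ (lift s '' (t : Set Plane)) = lowerHull s V

end QAdapted

/-!
A simplex spans a face of the lower hull of the lifted points if and only if no affine dependence
among the points of `V` that is nonnegative off the vertices of the simplex lowers the heights
(linear programming duality). The coefficients of the hinge formula form an affine dependence of
`i`, `j`, `k`, `l`, with positive coefficients at `k` and `l`. Hence the conductivity is nonnegative
whenever `i j` spans a lower face, and it vanishes on affine functions, so that its sign compares
`s` with the plane through three of the lifted points.

A triangulation by lower faces comes from perturbing the heights by a small multiple of generic
heights in strictly convex position (a perturbed paraboloid): faces of the perturbed lower hull are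
simplices and still lie in faces of the original one.

For uniqueness, walk from a point of a triangle straight to a vertex `v`, avoiding all other
vertices. When the walk crosses an interior edge, the value at `v` of the affine function that
interpolates `s` on the current triangle increases by a positive multiple of the conductivity of
that edge, and at the end it is `s v`. Thus the graph of the interpolant of every triangle of a
`Q`-adapted triangulation lies below the lifted points, strictly so off the triangle if no
conductivity vanishes, and this determines the complex.
-/

namespace QAdapted

open Filter Topology

section Perturbation

lemma eventually_nonneg_add_mul {c d : ℝ} (hc : 0 ≤ c) (hd : c = 0 → 0 ≤ d) :
    ∀ᶠ ε in 𝓝[>] (0 : ℝ), 0 ≤ c + ε * d := by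
  rcases hc.eq_or_lt with rfl | hc
  · filter_upwards [self_mem_nhdsWithin] with ε hε
    simpa only [zero_add] using mul_nonneg (le_of_lt hε) (hd rfl)
  · have hlim : Tendsto (fun ε ↦ c + ε * d) (𝓝[>] 0) (𝓝 c) :=
      (Continuous.tendsto' (by fun_prop) 0 c (by simp)).mono_left nhdsWithin_le_nhds
    exact (hlim.eventually_const_lt hc).mono fun _ ↦ le_of_lt

lemma eventually_add_mul_neg {c : ℝ} (hc : c < 0) (d : ℝ) :
    ∀ᶠ ε in 𝓝[>] (0 : ℝ), c + ε * d < 0 :=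
  ((Continuous.tendsto' (by fun_prop) 0 c (by simp)).mono_left
    nhdsWithin_le_nhds).eventually_lt_const hc

lemma eventually_add_mul_ne_zero (c : ℝ) {d : ℝ} (hd : d ≠ 0) :
    ∀ᶠ ε in 𝓝[>] (0 : ℝ), c + ε * d ≠ 0 := by
  rcases eq_or_ne c 0 with rfl | hc
  · filter_upwards [self_mem_nhdsWithin] with ε hε
    simpa only [zero_add] using mul_ne_zero (ne_of_gt hε) hd
  · exact ((Continuous.tendsto' (by fun_prop) 0 c (by simp)).mono_left
      nhdsWithin_le_nhds).eventually_ne hc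

end Perturbation

section LowerFaces

variable {E : Type*} [AddCommGroup E] [Module ℝ E] {V t u : Finset E} {a b μ ν w : E → ℝ} {x : E}

/-- `μ` is an affine dependence among the points of the finite set `V`, extended by zero. -/
structure IsAffineDependence (V : Finset E) (μ : E → ℝ) : Prop where
  eq_zero : ∀ v ∉ V, μ v = 0
  sum_eq_zero : ∑ v ∈ V, μ v = 0
  sum_smul_eq_zero : ∑ v ∈ V, μ v • v = 0

/-- `x` is the convex combination of the points of the finite set `V` with weights `a`. The weights
are extended by zero, so that they may be compared with weights on other finite sets. -/
structure IsConvexCombination (V : Finset E) (a : E → ℝ) (x : E) : Prop where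
  eq_zero : ∀ v ∉ V, a v = 0
  nonneg : ∀ v, 0 ≤ a v
  sum_eq_one : ∑ v ∈ V, a v = 1
  sum_smul_eq : ∑ v ∈ V, a v • v = x

namespace IsAffineDependence

lemma add (hμ : IsAffineDependence V μ) (hν : IsAffineDependence V ν) :
    IsAffineDependence V (μ + ν) where
  eq_zero v hv := by simp [hμ.eq_zero v hv, hν.eq_zero v hv]
  sum_eq_zero := by simp [Finset.sum_add_distrib, hμ.sum_eq_zero, hν.sum_eq_zero]
  sum_smul_eq_zero := by
    simp [add_smul, Finset.sum_add_distrib, hμ.sum_smul_eq_zero, hν.sum_smul_eq_zero]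

lemma smul (c : ℝ) (hμ : IsAffineDependence V μ) : IsAffineDependence V (c • μ) where
  eq_zero v hv := by simp [hμ.eq_zero v hv]
  sum_eq_zero := by simp [← Finset.mul_sum, hμ.sum_eq_zero]
  sum_smul_eq_zero := by simp [mul_smul, ← Finset.smul_sum, hμ.sum_smul_eq_zero]

lemma sum_mul_eq_of_subset (hμ : IsAffineDependence t μ) (htV : t ⊆ V) (w : E → ℝ) :
    ∑ v ∈ V, μ v * w v = ∑ v ∈ t, μ v * w v :=
  (Finset.sum_subset htV fun v _ hv ↦ by rw [hμ.eq_zero v hv, zero_mul]).symm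

lemma mono (hμ : IsAffineDependence t μ) (htV : t ⊆ V) : IsAffineDependence V μ where
  eq_zero v hv := hμ.eq_zero v fun h ↦ hv (htV h)
  sum_eq_zero := by rw [← Finset.sum_subset htV fun v _ ↦ hμ.eq_zero v, hμ.sum_eq_zero]
  sum_smul_eq_zero := by
    rw [← Finset.sum_subset htV fun v _ hv ↦ by rw [hμ.eq_zero v hv, zero_smul],
      hμ.sum_smul_eq_zero]

lemma sum_mul_affineMap (hμ : IsAffineDependence V μ) (f : E →ᵃ[ℝ] ℝ) :
    ∑ v ∈ V, μ v * f v = 0 := by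
  have hf : ∀ v, f v = f.linear v + f 0 := fun v ↦ congrFun f.decomp v
  calc ∑ v ∈ V, μ v * f v
      = f.linear (∑ v ∈ V, μ v • v) + (∑ v ∈ V, μ v) * f 0 := by
        simp only [map_sum, map_smul, smul_eq_mul, Finset.sum_mul, ← Finset.sum_add_distrib,
          ← mul_add, ← hf]
    _ = 0 := by rw [hμ.sum_smul_eq_zero, hμ.sum_eq_zero, map_zero, zero_mul, add_zero]

lemma eq_zero_of_affineIndependent (hμ : IsAffineDependence t μ)
    (ht : AffineIndependent ℝ ((↑) : t → E)) : μ = 0 := by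
  ext v
  by_cases hv : v ∈ t
  · refine (affineIndependent_iff.1 ht) Finset.univ (fun v ↦ μ v) ?_ ?_ ⟨v, hv⟩ (Finset.mem_univ _)
    · rw [Finset.sum_coe_sort t μ, hμ.sum_eq_zero]
    · rw [Finset.sum_coe_sort t fun v ↦ μ v • v, hμ.sum_smul_eq_zero]
  · exact hμ.eq_zero v hv

end IsAffineDependence

lemma exists_isAffineDependence_ne_zero (ht : ¬ AffineIndependent ℝ ((↑) : t → E)) :
    ∃ μ, IsAffineDependence t μ ∧ ∃ v ∈ t, μ v ≠ 0 := by
  classical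
  obtain ⟨μ, hsmul, hsum, v, hv, hne⟩ := exists_nontrivial_relation_sum_zero_of_not_affine_ind ht
  refine ⟨fun v ↦ if v ∈ t then μ v else 0, ⟨fun v hv ↦ if_neg hv, ?_, ?_⟩, v, hv, by simpa [hv]⟩
  · rwa [Finset.sum_congr rfl fun v hv ↦ if_pos hv]
  · simpa [ite_smul] using hsmul

namespace IsConvexCombination

lemma sub (ha : IsConvexCombination V a x) (hb : IsConvexCombination V b x) :
    IsAffineDependence V (a - b) where
  eq_zero v hv := by simp [ha.eq_zero v hv, hb.eq_zero v hv]
  sum_eq_zero := by simp [Finset.sum_sub_distrib, ha.sum_eq_one, hb.sum_eq_one]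
  sum_smul_eq_zero := by simp [sub_smul, Finset.sum_sub_distrib, ha.sum_smul_eq, hb.sum_smul_eq]

lemma add_isAffineDependence (ha : IsConvexCombination V a x) (hμ : IsAffineDependence V μ)
    (hnonneg : ∀ v ∈ V, 0 ≤ a v + μ v) : IsConvexCombination V (a + μ) x where
  eq_zero v hv := by simp [ha.eq_zero v hv, hμ.eq_zero v hv]
  nonneg v := by
    by_cases hv : v ∈ V
    · exact hnonneg v hv
    · simp [ha.eq_zero v hv, hμ.eq_zero v hv]
  sum_eq_one := by simp [Finset.sum_add_distrib, ha.sum_eq_one, hμ.sum_eq_zero]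
  sum_smul_eq := by
    simp [add_smul, Finset.sum_add_distrib, ha.sum_smul_eq, hμ.sum_smul_eq_zero]

lemma mono (ha : IsConvexCombination t a x) (htV : t ⊆ V) : IsConvexCombination V a x where
  eq_zero v hv := ha.eq_zero v fun h ↦ hv (htV h)
  nonneg := ha.nonneg
  sum_eq_one := by rw [← Finset.sum_subset htV fun v _ ↦ ha.eq_zero v, ha.sum_eq_one]
  sum_smul_eq := by
    rw [← Finset.sum_subset htV fun v _ hv ↦ by rw [ha.eq_zero v hv, zero_smul], ha.sum_smul_eq]

lemma sum_mul_eq_of_subset (ha : IsConvexCombination t a x) (htV : t ⊆ V) (w : E → ℝ) :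
    ∑ v ∈ V, a v * w v = ∑ v ∈ t, a v * w v :=
  (Finset.sum_subset htV fun v _ hv ↦ by rw [ha.eq_zero v hv, zero_mul]).symm

lemma restrict (ha : IsConvexCombination V a x) (htV : t ⊆ V) (h : ∀ v ∉ t, a v = 0) :
    IsConvexCombination t a x where
  eq_zero := h
  nonneg := ha.nonneg
  sum_eq_one := by rw [Finset.sum_subset htV fun v _ ↦ h v, ha.sum_eq_one]
  sum_smul_eq := by
    rw [Finset.sum_subset htV fun v _ hv ↦ by rw [h v hv, zero_smul], ha.sum_smul_eq]

lemma restrict_support (ha : IsConvexCombination V a x) :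
    IsConvexCombination {v ∈ V | 0 < a v} a x :=
  ha.restrict (Finset.filter_subset _ _) fun v hv ↦ by
    by_contra h
    exact hv (Finset.mem_filter.2 ⟨not_imp_comm.1 (ha.eq_zero v) h, (ha.nonneg v).lt_of_ne' h⟩)

lemma mem_convexHull (ha : IsConvexCombination V a x) : x ∈ convexHull ℝ (V : Set E) :=
  Finset.mem_convexHull'.2 ⟨a, fun v _ ↦ ha.nonneg v, ha.sum_eq_one, ha.sum_smul_eq⟩

lemma nonempty (ha : IsConvexCombination V a x) : V.Nonempty := by
  refine Finset.nonempty_of_sum_ne_zero (f := a) ?_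
  simp only [ha.sum_eq_one, ne_eq, one_ne_zero, not_false_eq_true]

lemma eq_of_affineIndependent (ha : IsConvexCombination t a x) (hb : IsConvexCombination t b x)
    (ht : AffineIndependent ℝ ((↑) : t → E)) : a = b :=
  sub_eq_zero.1 ((ha.sub hb).eq_zero_of_affineIndependent ht)

lemma isCompact_setOf [TopologicalSpace E] [IsTopologicalAddGroup E] [ContinuousSMul ℝ E]
    [T2Space E] (V : Finset E) (x : E) : IsCompact {a | IsConvexCombination V a x} := by
  have hclosed : IsClosed {a | IsConvexCombination V a x} := by
    have heq : {a | IsConvexCombination V a x} = {a | ∀ v ∉ V, a v = 0} ∩ {a | ∀ v, 0 ≤ a v} ∩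
        {a | ∑ v ∈ V, a v = 1} ∩ {a | ∑ v ∈ V, a v • v = x} :=
      Set.ext fun a ↦ ⟨fun ⟨h₁, h₂, h₃, h₄⟩ ↦ ⟨⟨⟨h₁, h₂⟩, h₃⟩, h₄⟩,
        fun ⟨⟨⟨h₁, h₂⟩, h₃⟩, h₄⟩ ↦ ⟨h₁, h₂, h₃, h₄⟩⟩
    rw [heq]
    simp only [Set.ofPred_forall]
    refine ((IsClosed.inter ?_ ?_).inter ?_).inter ?_
    · exact isClosed_iInter fun v ↦ isClosed_iInter fun _ ↦
        isClosed_eq (continuous_apply v) continuous_const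
    · exact isClosed_iInter fun v ↦ isClosed_le continuous_const (continuous_apply v)
    · exact isClosed_eq (by fun_prop) continuous_const
    · exact isClosed_eq (by fun_prop) continuous_const
  refine (isCompact_univ_pi fun _ ↦ isCompact_Icc (a := (0 : ℝ)) (b := 1)).of_isClosed_subset
    hclosed fun a ha v _ ↦ ⟨ha.nonneg v, ?_⟩
  by_cases hv : v ∈ V
  · exact ha.sum_eq_one ▸ Finset.single_le_sum (fun u _ ↦ ha.nonneg u) hv
  · exact (ha.eq_zero v hv).trans_le zero_le_one

end IsConvexCombination

lemma exists_isConvexCombination (hx : x ∈ convexHull ℝ (V : Set E)) :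
    ∃ a, IsConvexCombination V a x := by
  classical
  obtain ⟨a, hnonneg, hsum, hx⟩ := Finset.mem_convexHull'.1 hx
  refine ⟨fun v ↦ if v ∈ V then a v else 0, fun v hv ↦ if_neg hv, fun v ↦ ?_, ?_, ?_⟩
  · split_ifs with hv
    exacts [hnonneg v hv, le_rfl]
  · rwa [Finset.sum_congr rfl fun v hv ↦ if_pos hv]
  · simpa [ite_smul] using hx

/-- `t ⊆ V` spans a face of the lower hull of the graph of `w` over `V`. By linear programming
duality, this means that no affine dependence of `V` whose negative weights sit on `t` lowers the
heights; this form needs no supporting affine function, and it is linear in `w`. -/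
structure IsLowerFace (w : E → ℝ) (V t : Finset E) : Prop where
  subset : t ⊆ V
  sum_nonneg : ∀ μ, IsAffineDependence V μ → (∀ v ∉ t, 0 ≤ μ v) → 0 ≤ ∑ v ∈ V, μ v * w v

namespace IsLowerFace

lemma mono (h : IsLowerFace w V t) (hut : u ⊆ t) : IsLowerFace w V u where
  subset := hut.trans h.subset
  sum_nonneg μ hμ hnonneg := h.sum_nonneg μ hμ fun v hv ↦ hnonneg v fun hvu ↦ hv (hut hvu)

lemma add_smul {h : E → ℝ} {c : ℝ} (hw : IsLowerFace w V t) (hh : IsLowerFace h V t)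
    (hc : 0 ≤ c) : IsLowerFace (w + c • h) V t where
  subset := hw.subset
  sum_nonneg μ hμ hnonneg := by
    simp only [Pi.add_apply, Pi.smul_apply, smul_eq_mul, mul_add, mul_left_comm _ c,
      Finset.sum_add_distrib, ← Finset.mul_sum]
    exact add_nonneg (hw.sum_nonneg μ hμ hnonneg) (mul_nonneg hc (hh.sum_nonneg μ hμ hnonneg))

lemma of_affineMap_le (htV : t ⊆ V) (f : E →ᵃ[ℝ] ℝ) (hle : ∀ v ∈ V, f v ≤ w v)
    (heq : ∀ v ∈ t, f v = w v) : IsLowerFace w V t where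
  subset := htV
  sum_nonneg μ hμ hnonneg := by
    have hterm : ∀ v ∈ V, 0 ≤ μ v * (w v - f v) := fun v hv ↦ by
      by_cases hvt : v ∈ t
      · simp [heq v hvt]
      · exact mul_nonneg (hnonneg v hvt) (sub_nonneg.2 (hle v hv))
    simpa only [mul_sub, Finset.sum_sub_distrib, hμ.sum_mul_affineMap, sub_zero]
      using Finset.sum_nonneg hterm

lemma sum_le_sum (h : IsLowerFace w V t) (ha : IsConvexCombination t a x)
    (hb : IsConvexCombination V b x) : ∑ v ∈ V, a v * w v ≤ ∑ v ∈ V, b v * w v := by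
  have hba := h.sum_nonneg (b - a) (hb.sub (ha.mono h.subset)) fun v hv ↦ by
    simp [ha.eq_zero v hv, hb.nonneg v]
  simpa only [Pi.sub_apply, sub_mul, Finset.sum_sub_distrib, sub_nonneg] using hba

/-- Moving weight from `b` back to `a` leaves room for every dependence that is negative only on
`t` and on the support of `b`. -/
lemma union_support [DecidableEq E] (h : IsLowerFace w V t) (ha : IsConvexCombination t a x)
    (hb : IsConvexCombination V b x) (hle : ∑ v ∈ V, b v * w v ≤ ∑ v ∈ V, a v * w v) :
    IsLowerFace w V (t ∪ {v ∈ V | 0 < b v}) where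
  subset := Finset.union_subset h.subset (Finset.filter_subset _ _)
  sum_nonneg μ hμ hnonneg := by
    have hsmall : ∀ᶠ ε in 𝓝[>] (0 : ℝ), ∀ v ∈ V, v ∉ t → 0 ≤ b v + ε * μ v := by
      refine (Filter.eventually_all_finset V).2 fun v _ ↦ ?_
      by_cases hvt : v ∈ t
      · simp [hvt]
      · simp only [hvt, not_false_eq_true, forall_const]
        exact eventually_nonneg_add_mul (hb.nonneg v) fun hbv ↦ hnonneg v (by simp [hvt, hbv])
    obtain ⟨ε, hεμ, hε⟩ := (hsmall.and self_mem_nhdsWithin).exists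
    have hdep : IsAffineDependence V (b - a + ε • μ) :=
      (hb.sub (ha.mono h.subset)).add (hμ.smul ε)
    have hsum := h.sum_nonneg _ hdep fun v hvt ↦ by
      by_cases hv : v ∈ V
      · simpa [ha.eq_zero v hvt] using hεμ v hv hvt
      · exact (hdep.eq_zero v hv).ge
    simp only [Pi.add_apply, Pi.sub_apply, Pi.smul_apply, smul_eq_mul, add_mul, sub_mul,
      mul_assoc, Finset.sum_add_distrib, Finset.sum_sub_distrib, ← Finset.mul_sum] at hsum
    exact nonneg_of_mul_nonneg_right (by linarith) hε

lemma of_isMinOn (ha : IsConvexCombination V a x)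
    (hmin : ∀ b, IsConvexCombination V b x → ∑ v ∈ V, a v * w v ≤ ∑ v ∈ V, b v * w v) :
    IsLowerFace w V {v ∈ V | 0 < a v} where
  subset := Finset.filter_subset _ _
  sum_nonneg μ hμ hnonneg := by
    have hsmall : ∀ᶠ ε in 𝓝[>] (0 : ℝ), ∀ v ∈ V, 0 ≤ a v + ε * μ v :=
      (Filter.eventually_all_finset V).2 fun v _ ↦
        eventually_nonneg_add_mul (ha.nonneg v) fun hav ↦ hnonneg v (by simp [hav])
    obtain ⟨ε, hεμ, hε⟩ := (hsmall.and self_mem_nhdsWithin).exists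
    have hsum := hmin _ (ha.add_isAffineDependence (hμ.smul ε) hεμ)
    simp only [Pi.add_apply, Pi.smul_apply, smul_eq_mul, add_mul, mul_assoc,
      Finset.sum_add_distrib, ← Finset.mul_sum] at hsum
    exact nonneg_of_mul_nonneg_right (by linarith) hε

end IsLowerFace

lemma exists_isLowerFace_support [TopologicalSpace E] [IsTopologicalAddGroup E]
    [ContinuousSMul ℝ E] [T2Space E] (w : E → ℝ) (hx : x ∈ convexHull ℝ (V : Set E)) :
    ∃ a, IsConvexCombination V a x ∧ IsLowerFace w V {v ∈ V | 0 < a v} := by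
  obtain ⟨a, ha, hmin⟩ := (IsConvexCombination.isCompact_setOf V x).exists_isMinOn
    (exists_isConvexCombination hx) (f := fun a ↦ ∑ v ∈ V, a v * w v) (by fun_prop)
  exact ⟨a, ha, .of_isMinOn ha fun b hb ↦ hmin hb⟩

lemma eventually_isLowerFace_of_add_smul (w h : E → ℝ) (V : Finset E) :
    ∀ᶠ ε in 𝓝[>] (0 : ℝ), ∀ t, IsLowerFace (w + ε • h) V t → IsLowerFace w V t := by
  have hpowerset : ∀ᶠ ε in 𝓝[>] (0 : ℝ), ∀ t ∈ V.powerset,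
      IsLowerFace (w + ε • h) V t → IsLowerFace w V t := by
    refine (Filter.eventually_all_finset _).2 fun t ht ↦ ?_
    by_cases hwt : IsLowerFace w V t
    · exact .of_forall fun _ _ ↦ hwt
    obtain ⟨μ, hμ, hnonneg, hneg⟩ : ∃ μ, IsAffineDependence V μ ∧ (∀ v ∉ t, 0 ≤ μ v) ∧
        ∑ v ∈ V, μ v * w v < 0 := by
      by_contra! hcontra
      exact hwt ⟨Finset.mem_powerset.1 ht, hcontra⟩
    filter_upwards [eventually_add_mul_neg hneg (∑ v ∈ V, μ v * h v)] with ε hε hface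
    have hsum := hface.sum_nonneg μ hμ hnonneg
    simp only [Pi.add_apply, Pi.smul_apply, smul_eq_mul, mul_add, mul_left_comm _ ε,
      Finset.sum_add_distrib, ← Finset.mul_sum] at hsum
    exact absurd hε hsum.not_gt
  filter_upwards [hpowerset] with ε hε t ht
  exact hε t (Finset.mem_powerset.2 ht.subset) ht

end LowerFaces

section GenericHeights

variable {E : Type*} [AddCommGroup E] [Module ℝ E] {V t : Finset E} {a b w : E → ℝ} {x : E}

/-- No affine dependence of `V` is forced on the lifted points: every affinely dependent subset of
`V` has a dependence that the heights `w` violate. For such heights the faces of the lower hull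
are simplices. -/
def IsGenericHeight (w : E → ℝ) (V : Finset E) : Prop :=
  ∀ t ⊆ V, ¬ AffineIndependent ℝ ((↑) : t → E) →
    ∃ μ, IsAffineDependence t μ ∧ ∑ v ∈ t, μ v * w v ≠ 0

lemma exists_isGenericHeight (V : Finset E) : ∃ w : E → ℝ, IsGenericHeight w V := by
  classical
  let Dependent := {t : V.powerset // ¬ AffineIndependent ℝ ((↑) : t.1 → E)}
  choose μ hμ v hv hne using fun t : Dependent ↦ exists_isAffineDependence_ne_zero t.2
  let height (t : Dependent) : Module.Dual ℝ (E → ℝ) :=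
    ∑ v ∈ t.1.1, μ t v • LinearMap.proj v
  have hheight : ∀ t w, height t w = ∑ v ∈ t.1.1, μ t v * w v := fun t w ↦ by
    simp [height, LinearMap.sum_apply]
  obtain ⟨w, hw⟩ := Module.Dual.exists_forall_ne_zero_of_forall_exists height fun t ↦
    ⟨Pi.single (v t) 1, by simpa [hheight, Pi.single_apply, hv t] using hne t⟩
  refine ⟨w, fun t ht hdep ↦ ?_⟩
  let t' : Dependent := ⟨⟨t, Finset.mem_powerset.2 ht⟩, hdep⟩
  exact ⟨μ t', hμ t', hheight t' w ▸ hw t'⟩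

lemma IsGenericHeight.eventually_add_smul {h : E → ℝ} (hh : IsGenericHeight h V) (w : E → ℝ) :
    ∀ᶠ ε in 𝓝[>] (0 : ℝ), IsGenericHeight (w + ε • h) V := by
  have hpowerset : ∀ᶠ ε in 𝓝[>] (0 : ℝ), ∀ t ∈ V.powerset,
      ¬ AffineIndependent ℝ ((↑) : t → E) →
        ∃ μ, IsAffineDependence t μ ∧ ∑ v ∈ t, μ v * (w + ε • h) v ≠ 0 := by
    refine (Filter.eventually_all_finset _).2 fun t ht ↦ ?_
    by_cases hdep : AffineIndependent ℝ ((↑) : t → E)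
    · exact .of_forall fun _ hdep' ↦ absurd hdep hdep'
    obtain ⟨μ, hμ, hne⟩ := hh t (Finset.mem_powerset.1 ht) hdep
    filter_upwards [eventually_add_mul_ne_zero (∑ v ∈ t, μ v * w v) hne] with ε hε _
    refine ⟨μ, hμ, ?_⟩
    simpa only [Pi.add_apply, Pi.smul_apply, smul_eq_mul, mul_add, mul_left_comm _ ε,
      Finset.sum_add_distrib, ← Finset.mul_sum] using hε
  exact hpowerset.mono fun ε hε t ht ↦ hε t (Finset.mem_powerset.2 ht)

lemma IsLowerFace.affineIndependent (h : IsLowerFace w V t) (hw : IsGenericHeight w V) :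
    AffineIndependent ℝ ((↑) : t → E) := by
  by_contra hdep
  obtain ⟨μ, hμ, hne⟩ := hw t h.subset hdep
  have hsum : ∀ c : ℝ, 0 ≤ c * ∑ v ∈ t, μ v * w v := fun c ↦ by
    have hc := h.sum_nonneg _ ((hμ.smul c).mono h.subset) fun v hv ↦
      ((hμ.smul c).eq_zero v hv).ge
    rw [(hμ.smul c).sum_mul_eq_of_subset h.subset] at hc
    simpa only [Pi.smul_apply, smul_eq_mul, mul_assoc, ← Finset.mul_sum] using hc
  exact hne (le_antisymm (by linarith [hsum (-1)]) (by linarith [hsum 1]))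

lemma IsLowerFace.eq_of_sum_le (h : IsLowerFace w V t) (hw : IsGenericHeight w V)
    (ha : IsConvexCombination t a x) (hb : IsConvexCombination V b x)
    (hle : ∑ v ∈ V, b v * w v ≤ ∑ v ∈ V, a v * w v) : a = b := by
  classical
  exact (ha.mono Finset.subset_union_left).eq_of_affineIndependent
    (hb.restrict_support.mono Finset.subset_union_right)
    ((h.union_support ha hb hle).affineIndependent hw)

/-- The projection of the lower hull of the graph of generic heights. -/
def lowerFaceComplex (w : E → ℝ) (V : Finset E) (hw : IsGenericHeight w V) :
    Geometry.SimplicialComplex ℝ E where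
  faces := {t | t.Nonempty ∧ IsLowerFace w V t}
  isRelLowerSet_faces := by
    rintro t ⟨ht, h⟩
    exact ⟨ht, fun u hut hu ↦ ⟨hu, h.mono hut⟩⟩
  indep h := h.2.affineIndependent hw
  inter_subset_convexHull := by
    classical
    rintro t u ⟨-, ht⟩ ⟨-, hu⟩ x ⟨hxt, hxu⟩
    obtain ⟨a, ha⟩ := exists_isConvexCombination hxt
    obtain ⟨b, hb⟩ := exists_isConvexCombination hxu
    obtain rfl : a = b := ht.eq_of_sum_le hw ha (hb.mono hu.subset)
      (hu.sum_le_sum hb (ha.mono ht.subset))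
    have hab : IsConvexCombination (t ∩ u) a x :=
      ha.restrict Finset.inter_subset_left fun v hv ↦ by
        by_cases hvt : v ∈ t
        · exact hb.eq_zero v fun hvu ↦ hv (Finset.mem_inter.2 ⟨hvt, hvu⟩)
        · exact ha.eq_zero v hvt
    simpa only [Finset.coe_inter] using hab.mem_convexHull

lemma space_lowerFaceComplex [TopologicalSpace E] [IsTopologicalAddGroup E]
    [ContinuousSMul ℝ E] [T2Space E] (hw : IsGenericHeight w V) :
    (lowerFaceComplex w V hw).space = convexHull ℝ (V : Set E) := by
  ext x
  refine ⟨fun hx ↦ ?_, fun hx ↦ ?_⟩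
  · obtain ⟨t, ⟨-, ht⟩, hxt⟩ := Geometry.SimplicialComplex.mem_space_iff.1 hx
    exact convexHull_mono (Finset.coe_subset.2 ht.subset) hxt
  · obtain ⟨a, ha, hface⟩ := exists_isLowerFace_support w hx
    exact Geometry.SimplicialComplex.mem_space_iff.2
      ⟨_, ⟨ha.restrict_support.nonempty, hface⟩, ha.restrict_support.mem_convexHull⟩

lemma vertices_lowerFaceComplex (hw : IsGenericHeight w V)
    (hsingleton : ∀ v ∈ V, IsLowerFace w V {v}) :
    (lowerFaceComplex w V hw).vertices = (V : Set E) := by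
  ext v
  rw [Geometry.SimplicialComplex.mem_vertices]
  exact ⟨fun h ↦ Finset.singleton_subset_iff.1 h.2.subset,
    fun hv ↦ ⟨Finset.singleton_nonempty v, hsingleton v hv⟩⟩

end GenericHeights

section InnerProductSpace

variable {E : Type*} [NormedAddCommGroup E] [InnerProductSpace ℝ E]

/-- The paraboloid lifts the points of `V` into strictly convex position, which survives a small
generic perturbation. -/
lemma exists_isGenericHeight_isLowerFace_singleton (V : Finset E) :
    ∃ h : E → ℝ, IsGenericHeight h V ∧ ∀ v ∈ V, IsLowerFace h V {v} := by
  obtain ⟨ψ, hψ⟩ := exists_isGenericHeight V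
  have hclose : ∀ᶠ ε in 𝓝[>] (0 : ℝ), ∀ v ∈ V, ∀ u ∈ V, 0 ≤ ‖u - v‖ ^ 2 + ε * (ψ u - ψ v) := by
    refine (Filter.eventually_all_finset V).2 fun v _ ↦
      (Filter.eventually_all_finset V).2 fun u _ ↦
        eventually_nonneg_add_mul (sq_nonneg _) fun huv ↦ ?_
    rw [sub_eq_zero.1 (norm_eq_zero.1 (pow_eq_zero_iff two_ne_zero |>.1 huv)), sub_self]
  obtain ⟨ε, hgeneric, hε⟩ := ((hψ.eventually_add_smul fun v ↦ ‖v‖ ^ 2).and hclose).exists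
  refine ⟨_, hgeneric, fun v hv ↦ ?_⟩
  let tangent : E →ᵃ[ℝ] ℝ := (2 • (innerₗ E v)).toAffineMap +
    AffineMap.const ℝ E (ε * ψ v - ‖v‖ ^ 2)
  have htangent : ∀ u, ‖u‖ ^ 2 + ε * ψ u = tangent u + (‖u - v‖ ^ 2 + ε * (ψ u - ψ v)) :=
    fun u ↦ by
      simp only [tangent, norm_sub_sq_real, real_inner_comm, AffineMap.coe_add, Pi.add_apply,
        LinearMap.coe_toAffineMap, LinearMap.smul_apply, innerₗ_apply_apply, AffineMap.const_apply,
        nsmul_eq_mul, Nat.cast_ofNat]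
      ring
  refine .of_affineMap_le (Finset.singleton_subset_iff.2 hv) tangent (fun u hu ↦ ?_) fun u hu ↦ ?_
  · exact (le_add_of_nonneg_right (hε v hv u hu)).trans_eq (htangent u).symm
  · obtain rfl := Finset.mem_singleton.1 hu
    simpa using (htangent u).symm

theorem exists_complex_forall_isLowerFace {V : Finset E} {s : E → ℝ}
    (hs : ∀ v ∈ V, IsLowerFace s V {v}) :
    ∃ K : Geometry.SimplicialComplex ℝ E, K.vertices = (V : Set E) ∧
      K.space = convexHull ℝ (V : Set E) ∧ ∀ t ∈ K.faces, IsLowerFace s V t := by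
  obtain ⟨h, hgeneric, hh⟩ := exists_isGenericHeight_isLowerFace_singleton V
  obtain ⟨ε, ⟨hgeneric', hface⟩, hε⟩ := ((hgeneric.eventually_add_smul s).and
    (eventually_isLowerFace_of_add_smul s h V)).and self_mem_nhdsWithin |>.exists
  exact ⟨lowerFaceComplex _ V hgeneric', vertices_lowerFaceComplex hgeneric' fun v hv ↦
    (hs v hv).add_smul (hh v hv) (le_of_lt hε), space_lowerFaceComplex hgeneric',
    fun t ht ↦ hface t ht.2⟩

end InnerProductSpace

section Simplices

variable {E : Type*} [AddCommGroup E] [Module ℝ E] {t u : Finset E} {a : E → ℝ} {A : Set E} {x : E}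

lemma affineMap_eq_zero_of_mem_convexHull {f : E →ᵃ[ℝ] ℝ} (hf : ∀ v ∈ A, f v = 0)
    (hx : x ∈ convexHull ℝ A) : f x = 0 :=
  convexHull_min hf ((convex_singleton 0).affine_preimage f) hx

lemma exists_affineMap_eq (ht : AffineIndependent ℝ ((↑) : t → E)) (w : E → ℝ) :
    ∃ f : E →ᵃ[ℝ] ℝ, ∀ v ∈ t, f v = w v := by
  classical
  obtain ⟨T, htT, hT, hspan⟩ := exists_subset_affineIndependent_affineSpan_eq_top
    (s := (t : Set E)) ht
  let b : AffineBasis T ℝ E := ⟨(↑), hT, by rw [Subtype.range_coe]; exact hspan⟩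
  have hcoord : ∀ u v : t, b.coord ⟨u, htT u.2⟩ v = if u = v then 1 else 0 := fun u v ↦ by
    refine (b.coord_apply ⟨u, htT u.2⟩ ⟨v, htT v.2⟩).trans ?_
    simp only [Subtype.mk.injEq, SetCoe.ext_iff]
  let eval (x : E) : (E →ᵃ[ℝ] ℝ) →+ ℝ := ⟨⟨fun f ↦ f x, rfl⟩, fun _ _ ↦ rfl⟩
  refine ⟨∑ u : t, w u • b.coord ⟨u, htT u.2⟩, fun v hv ↦ ?_⟩
  calc eval v (∑ u : t, w u • b.coord ⟨u, htT u.2⟩)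
      = ∑ u : t, w u * b.coord ⟨u, htT u.2⟩ v := map_sum _ _ _
    _ = w v := by simp [fun u ↦ hcoord u ⟨v, hv⟩]

lemma exists_isConvexCombination_pos (ht : t.Nonempty) :
    ∃ a x, IsConvexCombination t a x ∧ ∀ v ∈ t, 0 < a v := by
  classical
  have hcard : (0 : ℝ) < t.card := Nat.cast_pos.2 ht.card_pos
  refine ⟨fun v ↦ if v ∈ t then (t.card : ℝ)⁻¹ else 0, _,
    ⟨fun v hv ↦ if_neg hv, fun v ↦ ?_, ?_, rfl⟩, fun v hv ↦ by simp [hv, hcard]⟩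
  · split_ifs
    exacts [inv_nonneg.2 hcard.le, le_rfl]
  · simp [hcard.ne']

lemma IsConvexCombination.subset_of_mem_convexHull {K : Geometry.SimplicialComplex ℝ E}
    (ha : IsConvexCombination t a x) (hpos : ∀ v ∈ t, 0 < a v) (ht : t ∈ K.faces)
    (hu : u ∈ K.faces) (hx : x ∈ convexHull ℝ (u : Set E)) : t ⊆ u := by
  classical
  have hxtu := K.inter_subset_convexHull ht hu ⟨ha.mem_convexHull, hx⟩
  rw [← Finset.coe_inter] at hxtu
  obtain ⟨b, hb⟩ := exists_isConvexCombination hxtu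
  obtain rfl : a = b :=
    ha.eq_of_affineIndependent (hb.mono Finset.inter_subset_left) (K.indep ht)
  intro v hv
  by_contra hvu
  exact (hpos v hv).ne' (hb.eq_zero v fun h ↦ hvu (Finset.mem_inter.1 h).2)

end Simplices

section LowerHull

variable {V t : Finset Plane} {K : PlaneComplex} {s : Plane → ℝ} {v x : Plane} {z : ℝ}

lemma mem_convexHull_lift_iff : (x, z) ∈ convexHull ℝ (lift s '' (t : Set Plane)) ↔
    ∃ a, IsConvexCombination t a x ∧ ∑ v ∈ t, a v * s v = z := by
  classical
  have hinj : Function.Injective (lift s) := fun u v huv ↦ congrArg Prod.fst huv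
  constructor
  · rw [← Finset.coe_image]
    intro hxz
    obtain ⟨b, hb⟩ := exists_isConvexCombination hxz
    have hsum : (∑ v ∈ t, b (lift s v) • lift s v) = (x, z) := by
      rw [← hb.sum_smul_eq, Finset.sum_image hinj.injOn]
    refine ⟨b ∘ lift s, ⟨fun v hv ↦ hb.eq_zero _ ?_, fun v ↦ hb.nonneg _, ?_, ?_⟩, ?_⟩
    · rwa [hinj.mem_finset_image]
    · rw [← hb.sum_eq_one, Finset.sum_image hinj.injOn]
      rfl
    · simpa [lift, Prod.fst_sum] using congrArg Prod.fst hsum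
    · simpa [lift, Prod.snd_sum] using congrArg Prod.snd hsum
  · rintro ⟨a, ha, rfl⟩
    have hmem := (convex_convexHull ℝ (lift s '' (t : Set Plane))).sum_mem
      (fun v _ ↦ ha.nonneg v) ha.sum_eq_one
      fun v hv ↦ subset_convexHull ℝ _ (Set.mem_image_of_mem (lift s) (Finset.mem_coe.2 hv))
    convert hmem using 1
    simp [lift, Prod.ext_iff, Prod.fst_sum, Prod.snd_sum, ha.sum_smul_eq]

lemma IsLowerFace.convexHull_lift_subset (h : IsLowerFace s V t) :
    convexHull ℝ (lift s '' (t : Set Plane)) ⊆ lowerHull s V := by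
  rintro ⟨x, z⟩ hxz
  refine ⟨convexHull_mono (Set.image_mono (Finset.coe_subset.2 h.subset)) hxz, fun z' hz' ↦ ?_⟩
  obtain ⟨a, ha, rfl⟩ := mem_convexHull_lift_iff.1 hxz
  obtain ⟨b, hb, rfl⟩ := mem_convexHull_lift_iff.1 hz'
  rw [← ha.sum_mul_eq_of_subset h.subset]
  exact h.sum_le_sum ha hb

lemma IsLowerFace.of_convexHull_lift_subset (htV : t ⊆ V) (ht : t.Nonempty)
    (h : convexHull ℝ (lift s '' (t : Set Plane)) ⊆ lowerHull s V) : IsLowerFace s V t := by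
  obtain ⟨a, x, ha, hpos⟩ := exists_isConvexCombination_pos ht
  have hsupport : {v ∈ V | 0 < a v} = t := by
    ext v
    simp only [Finset.mem_filter]
    refine ⟨fun hv ↦ ?_, fun hv ↦ ⟨htV hv, hpos v hv⟩⟩
    by_contra hvt
    exact hv.2.ne' (ha.eq_zero v hvt)
  rw [← hsupport]
  refine .of_isMinOn (ha.mono htV) fun b hb ↦ ?_
  rw [ha.sum_mul_eq_of_subset htV]
  exact (h (mem_convexHull_lift_iff.2 ⟨a, ha, rfl⟩)).2 _ (mem_convexHull_lift_iff.2 ⟨b, hb, rfl⟩)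

lemma lift_mem_lowerHull_iff (hv : v ∈ V) : lift s v ∈ lowerHull s V ↔ IsLowerFace s V {v} := by
  refine ⟨fun h ↦ .of_convexHull_lift_subset (Finset.singleton_subset_iff.2 hv)
    (Finset.singleton_nonempty v) ?_, fun h ↦ h.convexHull_lift_subset ?_⟩
  · simpa using h
  · simp

lemma lift_mem_lowerHull_of_convexOn (hs : ConvexOn ℝ (convexHull ℝ (V : Set Plane)) s)
    (hv : v ∈ V) : lift s v ∈ lowerHull s V := by
  refine ⟨subset_convexHull ℝ _ (Set.mem_image_of_mem _ hv), fun z hz ↦ ?_⟩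
  obtain ⟨a, ha, rfl⟩ := mem_convexHull_lift_iff.1 hz
  calc s v = s (∑ u ∈ V, a u • u) := congrArg s ha.sum_smul_eq.symm
    _ ≤ ∑ u ∈ V, a u * s u := hs.map_sum_le (fun u _ ↦ ha.nonneg u) ha.sum_eq_one
        fun u hu ↦ subset_convexHull ℝ _ hu

lemma IsTriangulation.isLowerHullProjection (hK : IsTriangulation V K)
    (hfaces : ∀ t ∈ K.faces, IsLowerFace s V t) : IsLowerHullProjection s V K where
  vertices_subset := hK.vertices_eq.subset
  lift_eq := by
    refine subset_antisymm (Set.iUnion₂_subset fun t ht ↦ (hfaces t ht).convexHull_lift_subset) ?_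
    rintro ⟨x, z⟩ hxz
    obtain ⟨b, hb, -⟩ := mem_convexHull_lift_iff.1 hxz.1
    obtain ⟨t, ht, hxt⟩ := Geometry.SimplicialComplex.mem_space_iff.1
      (hK.space_eq.symm ▸ hb.mem_convexHull)
    obtain ⟨a, ha⟩ := exists_isConvexCombination hxt
    have hat : (x, ∑ v ∈ t, a v * s v) ∈ convexHull ℝ (lift s '' (t : Set Plane)) :=
      mem_convexHull_lift_iff.2 ⟨a, ha, rfl⟩
    have hlower := (hfaces t ht).convexHull_lift_subset hat
    obtain rfl : z = ∑ v ∈ t, a v * s v := le_antisymm (hxz.2 _ hlower.1) (hlower.2 _ hxz.1)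
    exact Set.mem_biUnion ht hat

end LowerHull

section Triangles

variable {K : PlaneComplex} {s : Plane → ℝ} {a b c i j k l : Plane}

/-- Twice the signed area of the triangle `a b c`, positive when `a`, `b`, `c` are in
counterclockwise order. -/
noncomputable def doubleArea (a b c : Plane) : ℝ :=
  (b 0 - a 0) * (c 1 - a 1) - (b 1 - a 1) * (c 0 - a 0)

/-- The rotation of the plane by a right angle. -/
noncomputable def rotate (x : Plane) : Plane := !₂[-x 1, x 0]

lemma two_mul_triangleArea (a b c : Plane) : 2 * triangleArea a b c = |doubleArea a b c| :=
  mul_div_cancel₀ _ two_ne_zero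

lemma doubleArea_swap (a b c : Plane) : doubleArea b a c = -doubleArea a b c := by
  unfold doubleArea
  ring

lemma real_inner_eq (x y : Plane) : inner ℝ x y = x 0 * y 0 + x 1 * y 1 := by
  simp [PiLp.inner_apply, Fin.sum_univ_two, mul_comm]

lemma dist_sq_eq (x y : Plane) : dist x y ^ 2 = (x 0 - y 0) ^ 2 + (x 1 - y 1) ^ 2 := by
  rw [EuclideanSpace.dist_sq_eq]
  simp [Fin.sum_univ_two, Real.dist_eq, sq_abs]

lemma doubleArea_add_rotate (a b : Plane) : doubleArea a b (a + rotate (b - a)) = dist a b ^ 2 := by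
  simp [dist_sq_eq, doubleArea, rotate]
  ring

lemma doubleArea_smul (a b c x : Plane) : doubleArea a b c • x =
    doubleArea x b c • a + doubleArea a x c • b + doubleArea a b x • c := by
  ext n
  fin_cases n <;> simp [doubleArea] <;> ring

lemma doubleArea_eq_add (a b c x : Plane) :
    doubleArea a b c = doubleArea x b c + doubleArea a x c + doubleArea a b x := by
  unfold doubleArea
  ring

lemma doubleArea_mul_affineMap (a b c x : Plane) (f : Plane →ᵃ[ℝ] ℝ) : doubleArea a b c * f x =
    doubleArea x b c * f a + doubleArea a x c * f b + doubleArea a b x * f c := by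
  have hf : ∀ v, f v = f.linear v + f 0 := fun v ↦ congrFun f.decomp v
  have hlinear := congrArg f.linear (doubleArea_smul a b c x)
  simp only [map_add, map_smul, smul_eq_mul] at hlinear
  rw [hf x, hf a, hf b, hf c]
  linear_combination hlinear + f 0 * doubleArea_eq_add a b c x

lemma mem_convexHull_of_doubleArea {x : Plane} (h : doubleArea a b c ≠ 0)
    (ha : 0 ≤ doubleArea x b c / doubleArea a b c) (hb : 0 ≤ doubleArea a x c / doubleArea a b c)
    (hc : 0 ≤ doubleArea a b x / doubleArea a b c) :
    x ∈ convexHull ℝ ({a, b, c} : Set Plane) := by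
  have hx : x = ∑ n, ![doubleArea x b c / doubleArea a b c, doubleArea a x c / doubleArea a b c,
      doubleArea a b x / doubleArea a b c] n • ![a, b, c] n := by
    simp only [Fin.sum_univ_three, Matrix.cons_val, div_eq_inv_mul, mul_smul, ← smul_add,
      ← doubleArea_smul, inv_smul_smul₀ h]
  rw [hx]
  refine (convex_convexHull ℝ _).sum_mem (fun n _ ↦ ?_) ?_ fun n _ ↦ subset_convexHull ℝ _ ?_
  · fin_cases n <;> assumption
  · simp only [Fin.sum_univ_three, Matrix.cons_val, ← add_div, ← doubleArea_eq_add, div_self h]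
  · fin_cases n <;> simp

lemma cot_angle (hab : a ≠ b) (hcb : c ≠ b) : Real.cot (EuclideanGeometry.angle a b c) =
    inner ℝ (a - b) (c - b) / |doubleArea a b c| := by
  have hnorm : ‖a - b‖ * ‖c - b‖ ≠ 0 :=
    mul_ne_zero (norm_sub_eq_zero_iff.not.2 hab) (norm_sub_eq_zero_iff.not.2 hcb)
  have hgram : inner ℝ (a - b) (a - b) * inner ℝ (c - b) (c - b)
      - inner ℝ (a - b) (c - b) * inner ℝ (a - b) (c - b) = doubleArea a b c ^ 2 := by
    simp only [real_inner_eq, doubleArea, PiLp.sub_apply]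
    ring
  have hsin := InnerProductGeometry.sin_angle_mul_norm_mul_norm (a - b) (c - b)
  rw [hgram, Real.sqrt_sq_eq_abs] at hsin
  rw [EuclideanGeometry.angle, Real.cot_eq_cos_div_sin, vsub_eq_sub, vsub_eq_sub,
    ← mul_div_mul_right _ _ hnorm, hsin, InnerProductGeometry.cos_angle_mul_norm_mul_norm]

lemma cot_angle_add_cot_angle (hij : i ≠ j) (hjk : j ≠ k) (hik : i ≠ k) :
    Real.cot (EuclideanGeometry.angle i j k) + Real.cot (EuclideanGeometry.angle j i k) =
      dist i j ^ 2 / |doubleArea i j k| := by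
  rw [cot_angle hij hjk.symm, cot_angle hij.symm hik.symm, doubleArea_swap i j, abs_neg, ← add_div,
    real_inner_eq, real_inner_eq, dist_sq_eq]
  simp only [PiLp.sub_apply]
  ring

/-- The altitude of the triangle through `k` meets the line `i j` in the point whose weights at `i`
and `j` are proportional to the cotangents of the angles at `j` and `i`. -/
lemma cot_angle_smul_add_cot_angle_smul (hij : i ≠ j) (hjk : j ≠ k) (hik : i ≠ k) :
    Real.cot (EuclideanGeometry.angle i j k) • i + Real.cot (EuclideanGeometry.angle j i k) • j =
      (dist i j ^ 2 / |doubleArea i j k|) • k -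
        (doubleArea i j k / |doubleArea i j k|) • rotate (j - i) := by
  rw [cot_angle hij hjk.symm, cot_angle hij.symm hik.symm, doubleArea_swap i j, abs_neg]
  simp only [div_eq_inv_mul, mul_smul, ← smul_add, ← smul_sub]
  congr 1
  ext n
  fin_cases n <;> simp [real_inner_eq, dist_sq_eq, doubleArea, rotate] <;> ring

namespace IsTriangle

open scoped Classical in
lemma mem_faces (h : IsTriangle K a b c) : {a, b, c} ∈ K.faces := by
  obtain ⟨t, ht, hcoe⟩ := h.face
  convert ht
  exact Finset.coe_injective (by simpa using hcoe.symm)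

lemma exists_affineMap (h : IsTriangle K a b c) (x y z : ℝ) :
    ∃ f : Plane →ᵃ[ℝ] ℝ, f a = x ∧ f b = y ∧ f c = z := by
  classical
  obtain ⟨f, hf⟩ := exists_affineMap_eq (K.indep h.mem_faces)
    (Function.update (Function.update (fun _ ↦ z) b y) a x)
  refine ⟨f, (hf a (by simp)).trans (by simp), (hf b (by simp)).trans ?_,
    (hf c (by simp)).trans ?_⟩
  · simp [h.ne_ab.symm]
  · simp [h.ne_ac.symm, h.ne_bc.symm]

lemma doubleArea_ne_zero (h : IsTriangle K a b c) : doubleArea a b c ≠ 0 := by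
  intro hzero
  obtain ⟨f, hfa, hfb, hfc⟩ := h.exists_affineMap 0 0 1
  have hdist := doubleArea_mul_affineMap a b c (a + rotate (b - a)) f
  rw [hzero, hfa, hfb, hfc, doubleArea_add_rotate] at hdist
  exact pow_ne_zero 2 (dist_ne_zero.2 h.ne_ab) (by linarith)

lemma triangleArea_pos (h : IsTriangle K a b c) : 0 < triangleArea a b c :=
  half_pos (abs_pos.2 h.doubleArea_ne_zero)

end IsTriangle

open scoped Classical in
/-- The coefficients of the hinge formula, as a function of the node. -/
noncomputable def hingeWeight (i j k l : Plane) : Plane → ℝ :=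
  (Pi.single i (-(1 / dist i j ^ 2) *
    (Real.cot (EuclideanGeometry.angle i j k) + Real.cot (EuclideanGeometry.angle i j l))) :
      Plane → ℝ) +
  (Pi.single j (-(1 / dist i j ^ 2) *
    (Real.cot (EuclideanGeometry.angle j i k) + Real.cot (EuclideanGeometry.angle j i l))) :
      Plane → ℝ) +
  (Pi.single k (1 / (2 * triangleArea i j k)) : Plane → ℝ) +
  (Pi.single l (1 / (2 * triangleArea i j l)) : Plane → ℝ)

namespace IsHinge

lemma inter_convexHull_subset (h : IsHinge K i j k l) :
    convexHull ℝ {i, j, k} ∩ convexHull ℝ {i, j, l} ⊆ convexHull ℝ {i, j} := by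
  obtain ⟨t, ht, htcoe⟩ := h.left.face
  obtain ⟨u, hu, hucoe⟩ := h.right.face
  rw [← htcoe, ← hucoe]
  refine (K.inter_subset_convexHull ht hu).trans (convexHull_mono ?_)
  rw [htcoe, hucoe]
  rintro v ⟨rfl | rfl | rfl, hv⟩
  · simp
  · simp
  · simp [h.ne, h.left.ne_ac.symm, h.left.ne_bc.symm] at hv

/-- If `k` and `l` were on the same side of the edge, then a point close to the midpoint of the
edge would belong to both triangles without being on the edge. -/
lemma doubleArea_mul_neg (h : IsHinge K i j k l) : doubleArea i j k * doubleArea i j l < 0 := by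
  have hl := h.right.doubleArea_ne_zero
  by_contra! hside
  have hratio : 0 ≤ doubleArea i j k / doubleArea i j l := by
    rw [← mul_div_mul_right _ _ hl]
    exact div_nonneg hside (mul_self_nonneg _)
  obtain ⟨ε, ⟨⟨hi, hj⟩, hε1⟩, hε : 0 < ε⟩ := (((eventually_nonneg_add_mul one_half_pos.le
    (d := doubleArea k j l / doubleArea i j l - 1 / 2) (by norm_num)).and
    (eventually_nonneg_add_mul one_half_pos.le
    (d := doubleArea i k l / doubleArea i j l - 1 / 2) (by norm_num))).and
    (Ioc_mem_nhdsGT one_pos)).and self_mem_nhdsWithin |>.exists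
  let p : Plane := AffineMap.lineMap (midpoint ℝ i j) k ε
  have hmid : midpoint ℝ i j ∈ convexHull ℝ ({i, j, k} : Set Plane) :=
    (convex_convexHull ℝ _).midpoint_mem (subset_convexHull ℝ _ (by simp))
      (subset_convexHull ℝ _ (by simp))
  have hpk : p ∈ convexHull ℝ {i, j, k} := (convex_convexHull ℝ _).lineMap_mem hmid
    (subset_convexHull ℝ _ (by simp)) ⟨hε.le, hε1.2⟩
  have hpl : p ∈ convexHull ℝ {i, j, l} := by
    refine mem_convexHull_of_doubleArea hl (hi.trans_eq ?_) (hj.trans_eq ?_)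
      ((mul_nonneg hε.le hratio).trans_eq ?_) <;>
    · rw [eq_div_iff hl]
      field_simp
      simp [p, doubleArea, AffineMap.lineMap_apply, midpoint_eq_smul_add]
      ring
  obtain ⟨f, hfi, hfj, hfk⟩ := h.left.exists_affineMap 0 0 1
  have hfp : f p = 0 := affineMap_eq_zero_of_mem_convexHull (by simp [hfi, hfj])
    (h.inter_convexHull_subset ⟨hpk, hpl⟩)
  have hfpε : f p = ε := by
    rw [AffineMap.apply_lineMap, AffineMap.map_midpoint, hfi, hfj, hfk]
    simp [AffineMap.lineMap_apply]
  exact hε.ne' (hfpε.symm.trans hfp)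

lemma sum_hingeWeight_smul [DecidableEq Plane] {M : Type*} [AddCommGroup M] [Module ℝ M]
    (h : IsHinge K i j k l) (F : Plane → M) :
    ∑ v ∈ {i, j, k, l}, hingeWeight i j k l v • F v =
      (-(1 / dist i j ^ 2) * (Real.cot (EuclideanGeometry.angle i j k) +
        Real.cot (EuclideanGeometry.angle i j l))) • F i +
      (-(1 / dist i j ^ 2) * (Real.cot (EuclideanGeometry.angle j i k) +
        Real.cot (EuclideanGeometry.angle j i l))) • F j +
      (1 / (2 * triangleArea i j k)) • F k + (1 / (2 * triangleArea i j l)) • F l := by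
  have hij := h.left.ne_ab
  have hjk := h.left.ne_bc
  have hik := h.left.ne_ac
  have hjl := h.right.ne_bc
  have hil := h.right.ne_ac
  rw [Finset.sum_insert (by simp [hij, hik, hil]), Finset.sum_insert (by simp [hjk, hjl]),
    Finset.sum_insert (by simpa using h.ne), Finset.sum_singleton, ← add_assoc, ← add_assoc]
  simp only [hingeWeight, Pi.add_apply, Pi.single_apply, hij, hij.symm, hik, hik.symm, hil,
    hil.symm, hjk, hjk.symm, hjl, hjl.symm, h.ne, h.ne.symm, if_true, if_false, add_zero, zero_add]

lemma hingeConductivity_eq_sum [DecidableEq Plane] (h : IsHinge K i j k l) (s : Plane → ℝ) :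
    hingeConductivity s i j k l = ∑ v ∈ {i, j, k, l}, hingeWeight i j k l v * s v := by
  have hsum := h.sum_hingeWeight_smul s
  simp only [smul_eq_mul] at hsum
  rw [hsum, hingeConductivity]
  ring

lemma doubleArea_div_abs_add (h : IsHinge K i j k l) :
    doubleArea i j k / |doubleArea i j k| + doubleArea i j l / |doubleArea i j l| = 0 := by
  rcases mul_neg_iff.1 h.doubleArea_mul_neg with ⟨hk, hl⟩ | ⟨hk, hl⟩
  · rw [abs_of_pos hk, abs_of_neg hl, div_neg, div_self hk.ne', div_self hl.ne, add_neg_cancel]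
  · rw [abs_of_neg hk, abs_of_pos hl, div_neg, div_self hk.ne, div_self hl.ne', neg_add_cancel]

lemma isAffineDependence_hingeWeight [DecidableEq Plane] (h : IsHinge K i j k l) :
    IsAffineDependence {i, j, k, l} (hingeWeight i j k l) where
  eq_zero v hv := by
    simp only [Finset.mem_insert, Finset.mem_singleton, not_or] at hv
    simp [hingeWeight, hv]
  sum_eq_zero := by
    have hsum := h.sum_hingeWeight_smul fun _ ↦ (1 : ℝ)
    have hk := cot_angle_add_cot_angle h.left.ne_ab h.left.ne_bc h.left.ne_ac
    have hl := cot_angle_add_cot_angle h.left.ne_ab h.right.ne_bc h.right.ne_ac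
    have hdist : dist i j ^ 2 ≠ 0 := pow_ne_zero 2 (dist_ne_zero.2 h.left.ne_ab)
    simp only [smul_eq_mul, mul_one, two_mul_triangleArea] at hsum
    rw [hsum]
    linear_combination (-(1 / dist i j ^ 2)) * (hk + hl) -
      (1 / |doubleArea i j k| + 1 / |doubleArea i j l|) * div_self hdist
  sum_smul_eq_zero := by
    have hsum := h.sum_hingeWeight_smul fun v ↦ v
    have hk := cot_angle_smul_add_cot_angle_smul h.left.ne_ab h.left.ne_bc h.left.ne_ac
    have hl := cot_angle_smul_add_cot_angle_smul h.left.ne_ab h.right.ne_bc h.right.ne_ac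
    have hdist : dist i j ^ 2 ≠ 0 := pow_ne_zero 2 (dist_ne_zero.2 h.left.ne_ab)
    simp only [two_mul_triangleArea] at hsum
    rw [hsum]
    linear_combination (norm := module) (-(1 / dist i j ^ 2) : ℝ) • (hk + hl) +
      h.doubleArea_div_abs_add • ((1 / dist i j ^ 2) • rotate (j - i)) -
      div_self hdist • ((1 / |doubleArea i j k|) • k + (1 / |doubleArea i j l|) • l)

lemma hingeConductivity_eq_of_affineMap (h : IsHinge K i j k l) {f : Plane →ᵃ[ℝ] ℝ}
    (hi : f i = s i) (hj : f j = s j) : hingeConductivity s i j k l =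
      (s k - f k) / (2 * triangleArea i j k) + (s l - f l) / (2 * triangleArea i j l) := by
  classical
  calc hingeConductivity s i j k l
      = ∑ v ∈ {i, j, k, l}, hingeWeight i j k l v * s v -
          ∑ v ∈ {i, j, k, l}, hingeWeight i j k l v * f v := by
        rw [h.isAffineDependence_hingeWeight.sum_mul_affineMap, sub_zero,
          h.hingeConductivity_eq_sum]
    _ = ∑ v ∈ {i, j, k, l}, hingeWeight i j k l v • (s v - f v) := by
        simp only [smul_eq_mul, mul_sub, Finset.sum_sub_distrib]
    _ = _ := by
        rw [h.sum_hingeWeight_smul, hi, hj]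
        simp only [sub_self, smul_eq_mul, mul_zero, zero_add, one_div_mul_eq_div]

lemma hingeConductivity_pos_iff (h : IsHinge K i j k l) :
    0 < hingeConductivity s i j k l ↔ HingeConvex s i j k l := by
  have hk : 0 < 2 * triangleArea i j k := mul_pos two_pos h.left.triangleArea_pos
  have hl : 0 < 2 * triangleArea i j l := mul_pos two_pos h.right.triangleArea_pos
  constructor
  · intro hq
    obtain ⟨f, hfi, hfj, hfk⟩ := h.left.exists_affineMap (s i) (s j)
      (s k - hingeConductivity s i j k l * triangleArea i j k)
    have hfl := h.hingeConductivity_eq_of_affineMap hfi hfj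
    refine ⟨f, hfi, hfj, hfk.trans_lt (sub_lt_self _ (mul_pos hq h.left.triangleArea_pos)), ?_⟩
    have hhalf : (s l - f l) / (2 * triangleArea i j l) = hingeConductivity s i j k l / 2 := by
      rw [hfk, sub_sub_cancel, mul_div_mul_right _ _ h.left.triangleArea_pos.ne'] at hfl
      linarith
    exact sub_pos.1 ((div_pos_iff_of_pos_right hl).1 (hhalf ▸ half_pos hq))
  · rintro ⟨f, hfi, hfj, hfk, hfl⟩
    rw [h.hingeConductivity_eq_of_affineMap hfi hfj]
    exact add_pos (div_pos (sub_pos.2 hfk) hk) (div_pos (sub_pos.2 hfl) hl)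

lemma hingeConductivity_eq_zero_iff (h : IsHinge K i j k l) :
    hingeConductivity s i j k l = 0 ↔ HingeFlat s i j k l := by
  constructor
  · intro hq
    obtain ⟨f, hfi, hfj, hfk⟩ := h.left.exists_affineMap (s i) (s j) (s k)
    refine ⟨f, hfi, hfj, hfk, ?_⟩
    rw [h.hingeConductivity_eq_of_affineMap hfi hfj, hfk, sub_self, zero_div, zero_add,
      div_eq_zero_iff] at hq
    have hl := h.right.triangleArea_pos
    rcases hq with hq | hq <;> linarith
  · rintro ⟨f, hfi, hfj, hfk, hfl⟩
    rw [h.hingeConductivity_eq_of_affineMap hfi hfj, hfk, hfl]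
    simp

end IsHinge

end Triangles

section FullDimensionalFaces

variable {E : Type*} [NormedAddCommGroup E] [NormedSpace ℝ E] {K : Geometry.SimplicialComplex ℝ E}
  {x v : E}

lemma exists_mem_segment_forall_eq {C : Set E} (hC : IsClosed C) (hx : x ∈ C) (v : E) :
    ∃ z ∈ segment ℝ x v, z ∈ C ∧ ∀ y ∈ segment ℝ z v, y ∈ C → y = z := by
  have hcompact : IsCompact (segment ℝ x v ∩ C) := by
    rw [segment_eq_image_lineMap]
    exact (isCompact_Icc.image AffineMap.lineMap_continuous).inter_right hC
  obtain ⟨z, ⟨hz, hzC⟩, hmin⟩ := hcompact.exists_isMinOn ⟨x, left_mem_segment ℝ x v, hx⟩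
    (f := (dist · v)) (by fun_prop)
  refine ⟨z, hz, hzC, fun y hy hyC ↦ ?_⟩
  have hyx : y ∈ segment ℝ x v :=
    (convex_segment x v).segment_subset hz (right_mem_segment ℝ x v) hy
  have hle : dist z v ≤ dist y v := hmin ⟨hyx, hyC⟩
  have hadd : dist z y + dist y v = dist z v := (mem_segment_iff_wbtw.1 hy).dist_add_dist
  exact (dist_le_zero.1 (by linarith)).symm

variable [FiniteDimensional ℝ E]

lemma exists_mem_forall_notMem_affineSubspace {ι : Type*} {U : Set E} {I : Set ι}
    {A : ι → AffineSubspace ℝ E} (hU : IsOpen U) (hne : U.Nonempty) (hI : I.Finite)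
    (hA : ∀ i ∈ I, A i ≠ ⊤) : ∃ x ∈ U, ∀ i ∈ I, x ∉ A i := by
  borelize E
  let μ : MeasureTheory.Measure E := MeasureTheory.Measure.addHaar
  by_contra! hcover
  have hnull : μ (⋃ i ∈ I, (A i : Set E)) = 0 :=
    (MeasureTheory.measure_biUnion_null_iff hI.countable).2 fun i hi ↦
      MeasureTheory.Measure.addHaar_affineSubspace _ _ (hA i hi)
  exact (hU.measure_pos μ hne).ne' <| MeasureTheory.measure_mono_null
    (fun x hx ↦ Set.mem_iUnion₂.2 (by simpa using hcover x hx)) hnull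

/-- The lower-dimensional faces miss a dense set of points, and the union of the full-dimensional
faces is closed. -/
lemma exists_face_affineSpan_eq_top (hK : K.faces.Finite) (hx : x ∈ closure (interior K.space)) :
    ∃ t ∈ K.faces, affineSpan ℝ (t : Set E) = ⊤ ∧ x ∈ convexHull ℝ (t : Set E) := by
  let C : Set E := ⋃ t ∈ {t ∈ K.faces | affineSpan ℝ (t : Set E) = ⊤}, convexHull ℝ (t : Set E)
  have hC : IsClosed C := (hK.subset (Set.sep_subset _ _)).isClosed_biUnion fun t _ ↦
    t.finite_toSet.isClosed_convexHull ℝ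
  suffices x ∈ C by simpa [C, and_assoc] using this
  by_contra hxC
  obtain ⟨y, ⟨hyC, hy⟩, hyt⟩ := exists_mem_forall_notMem_affineSubspace
    (hC.isOpen_compl.inter isOpen_interior) (mem_closure_iff.1 hx Cᶜ hC.isOpen_compl hxC)
    (hK.subset (Set.sep_subset _ _)) fun t (ht : t ∈ {t ∈ K.faces | affineSpan ℝ (t : Set E) ≠ ⊤}) ↦
      ht.2
  obtain ⟨t, ht, hy⟩ := Geometry.SimplicialComplex.mem_space_iff.1 (interior_subset hy)
  by_cases hspan : affineSpan ℝ (t : Set E) = ⊤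
  · exact hyC (Set.mem_biUnion (x := t) ⟨ht, hspan⟩ hy)
  · exact hyt t ⟨ht, hspan⟩ (convexHull_subset_affineSpan _ hy)

lemma exists_face_mem_segment (hK : K.faces.Finite) {z : E} (hzv : z ≠ v)
    (hsegment : segment ℝ z v ⊆ closure (interior K.space)) :
    ∃ t ∈ K.faces, affineSpan ℝ (t : Set E) = ⊤ ∧ z ∈ convexHull ℝ (t : Set E) ∧
      ∃ y ∈ segment ℝ z v, y ≠ z ∧ y ∈ convexHull ℝ (t : Set E) := by
  let C : Set E := ⋃ t ∈ {t ∈ K.faces | z ∉ convexHull ℝ (t : Set E)}, convexHull ℝ (t : Set E)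
  have hC : IsClosed C := (hK.subset (Set.sep_subset _ _)).isClosed_biUnion fun t _ ↦
    t.finite_toSet.isClosed_convexHull ℝ
  have hzC : z ∉ C := by simp [C]
  have hlim : Tendsto (AffineMap.lineMap z v : ℝ → E) (𝓝[>] 0) (𝓝 z) :=
    (AffineMap.lineMap_continuous.tendsto' 0 z (AffineMap.lineMap_apply_zero z v)).mono_left
      nhdsWithin_le_nhds
  obtain ⟨r, hrC, hr⟩ := ((hlim.eventually (hC.isOpen_compl.mem_nhds hzC)).and
    (Ioc_mem_nhdsGT one_pos)).exists
  have hy : AffineMap.lineMap z v r ∈ segment ℝ z v := by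
    rw [segment_eq_image_lineMap]
    exact Set.mem_image_of_mem _ ⟨hr.1.le, hr.2⟩
  obtain ⟨t, ht, hspan, hyt⟩ := exists_face_affineSpan_eq_top hK (hsegment hy)
  refine ⟨t, ht, hspan, ?_, _, hy, ?_, hyt⟩
  · by_contra hzt
    exact hrC (Set.mem_biUnion (x := t) ⟨ht, hzt⟩ hyt)
  · rw [ne_eq, AffineMap.lineMap_eq_left_iff, not_or]
    exact ⟨hzv, hr.1.ne'⟩

end FullDimensionalFaces

section Comparison

variable {E : Type*} [AddCommGroup E] [Module ℝ E] {K K' : Geometry.SimplicialComplex ℝ E}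
  {V t T : Finset E} {w a : E → ℝ} {x y : E}

lemma affineMap_pos_of_notMem_convexHull {A : Set E} {f : E →ᵃ[ℝ] ℝ} {l : E} (hA : A.Nonempty)
    (hf : ∀ v ∈ A, f v = 0) (hl : 0 < f l) (hy : y ∈ convexHull ℝ (insert l A))
    (hyA : y ∉ convexHull ℝ A) : 0 < f y := by
  rw [convexHull_insert hA, mem_convexJoin] at hy
  obtain ⟨_, rfl, z, hz, c, d, hc, hd, hcd, rfl⟩ := hy
  rw [Convex.combo_affine_apply hcd, affineMap_eq_zero_of_mem_convexHull hf hz, smul_zero, add_zero]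
  refine mul_pos (hc.lt_of_ne' ?_) hl
  rintro rfl
  obtain rfl : d = 1 := by linarith
  exact hyA (by simpa using hz)

lemma IsLowerFace.subset_of_affineMap_lt (ht : IsLowerFace w V t) (hT : T ⊆ V) {f : E →ᵃ[ℝ] ℝ}
    (hf : ∀ v ∈ T, f v = w v) (hlt : ∀ v ∈ V, v ∉ T → f v < w v) (ha : IsConvexCombination t a x)
    (hpos : ∀ v ∈ t, 0 < a v) (hx : x ∈ convexHull ℝ (T : Set E)) : t ⊆ T := by
  obtain ⟨b, hb⟩ := exists_isConvexCombination hx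
  intro v hv
  by_contra hvT
  have hle := ht.sum_le_sum ha (hb.mono hT)
  have haf : ∑ u ∈ V, a u * f u = ∑ u ∈ V, b u * f u := by
    have := ((ha.mono ht.subset).sub (hb.mono hT)).sum_mul_affineMap f
    simpa only [Pi.sub_apply, sub_mul, Finset.sum_sub_distrib, sub_eq_zero] using this
  have hbw : ∑ u ∈ V, b u * w u = ∑ u ∈ V, b u * f u := by
    rw [hb.sum_mul_eq_of_subset hT, hb.sum_mul_eq_of_subset hT]
    exact Finset.sum_congr rfl fun u hu ↦ by rw [hf u hu]
  have hle_w : ∀ u ∈ V, f u ≤ w u := fun u hu ↦ by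
    by_cases huT : u ∈ T
    exacts [(hf u huT).le, (hlt u hu huT).le]
  have hlt_sum : ∑ u ∈ V, a u * f u < ∑ u ∈ V, a u * w u :=
    Finset.sum_lt_sum (fun u hu ↦ mul_le_mul_of_nonneg_left (hle_w u hu) (ha.nonneg u))
      ⟨v, ht.subset hv, mul_lt_mul_of_pos_left (hlt v (ht.subset hv) hvT) (hpos v hv)⟩
  linarith

lemma eq_of_faces_subset (hfaces : K.faces ⊆ K'.faces) (hspace : K'.space ⊆ K.space) : K = K' := by
  refine Geometry.SimplicialComplex.ext (hfaces.antisymm fun t ht ↦ ?_)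
  obtain ⟨a, x, ha, hpos⟩ := exists_isConvexCombination_pos (K'.nonempty_of_mem_faces ht)
  obtain ⟨T, hT, hxT⟩ := Geometry.SimplicialComplex.mem_space_iff.1
    (hspace (Geometry.SimplicialComplex.convexHull_subset_space ht ha.mem_convexHull))
  exact K.down_closed hT (ha.subset_of_mem_convexHull hpos ht (hfaces hT) hxT)
    (K'.nonempty_of_mem_faces ht)

end Comparison

section Triangulations

variable {V t T T' : Finset Plane} {K K' : PlaneComplex} {s : Plane → ℝ} {f g : Plane →ᵃ[ℝ] ℝ}
  {i j k l v x y z : Plane}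

lemma affineSpan_eq_top_of_not_collinear {A : Set Plane} (hA : ¬ Collinear ℝ A) :
    affineSpan ℝ A = ⊤ := by
  have hne : A.Nonempty := Set.nonempty_iff_ne_empty.2 fun h ↦ hA (h ▸ collinear_empty ℝ Plane)
  rw [collinear_iff_finrank_le_one, not_le] at hA
  rw [AffineSubspace.affineSpan_eq_top_iff_vectorSpan_eq_top_of_nonempty ℝ Plane Plane hne]
  refine Submodule.eq_top_of_finrank_eq (le_antisymm (Submodule.finrank_le _) ?_)
  rwa [finrank_euclideanSpace_fin]

lemma affineSpan_pair_ne_top (x y : Plane) : affineSpan ℝ {x, y} ≠ ⊤ := by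
  intro h
  have hle := collinear_iff_finrank_le_one.1 (collinear_pair ℝ x y)
  rw [← direction_affineSpan, h, AffineSubspace.direction_top, finrank_top,
    finrank_euclideanSpace_fin] at hle
  omega

lemma exists_mem_convexHull_forall_segment {A : Set Plane} (hA : affineSpan ℝ A = ⊤)
    (V : Finset Plane) (v : Plane) :
    ∃ x ∈ convexHull ℝ A, ∀ z ∈ segment ℝ x v, z ∈ V → z = v := by
  obtain ⟨x, hx, hline⟩ := exists_mem_forall_notMem_affineSubspace isOpen_interior
    (interior_convexHull_nonempty_iff_affineSpan_eq_top.2 hA) V.finite_toSet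
    (A := fun u ↦ line[ℝ, v, u]) fun u _ ↦ affineSpan_pair_ne_top v u
  refine ⟨x, interior_subset hx, fun z hz hzV ↦ ?_⟩
  by_contra hzv
  exact hline z hzV ((mem_segment_iff_wbtw.1 hz).left_mem_affineSpan_of_right_ne (Ne.symm hzv))

lemma exists_isTriangle (hT : T ∈ K.faces) (hspan : affineSpan ℝ (T : Set Plane) = ⊤) (hi : i ∈ T)
    (hj : j ∈ T) (hij : i ≠ j) : ∃ k, IsTriangle K i j k ∧ (T : Set Plane) = {i, j, k} := by
  classical
  have hcard : T.card = 3 := by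
    have h := (K.indep hT).affineSpan_eq_top_iff_card_eq_finrank_add_one.1
      (by simpa using hspan)
    rwa [Fintype.card_coe, finrank_euclideanSpace_fin] at h
  have hjT : j ∈ T.erase i := Finset.mem_erase.2 ⟨hij.symm, hj⟩
  obtain ⟨k, hk⟩ : ∃ k, (T.erase i).erase j = {k} := by
    rw [← Finset.card_eq_one, Finset.card_erase_of_mem hjT, Finset.card_erase_of_mem hi, hcard]
  have hkT : k ∈ (T.erase i).erase j := hk ▸ Finset.mem_singleton_self k
  have hT_eq : (T : Set Plane) = {i, j, k} := by
    rw [← Finset.insert_erase hi, ← Finset.insert_erase hjT, hk]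
    simp
  simp only [Finset.mem_erase] at hkT
  exact ⟨k, ⟨hij, hkT.1.symm, hkT.2.1.symm, T, hT, hT_eq⟩, hT_eq⟩

lemma exists_isHinge (hT : T ∈ K.faces) (hT' : T' ∈ K.faces)
    (hspan : affineSpan ℝ (T : Set Plane) = ⊤) (hspan' : affineSpan ℝ (T' : Set Plane) = ⊤)
    (hne : T ≠ T') (hxT : x ∈ convexHull ℝ (T : Set Plane))
    (hxT' : x ∈ convexHull ℝ (T' : Set Plane)) (hx : x ∉ K.vertices) : ∃ i j k l,
      IsHinge K i j k l ∧ (T : Set Plane) = {i, j, k} ∧ (T' : Set Plane) = {i, j, l} := by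
  obtain ⟨i, ⟨hiT, hiT'⟩, j, ⟨hjT, hjT'⟩, hij⟩ : (T ∩ T' : Set Plane).Nontrivial := by
    by_contra hsub
    rw [Set.not_nontrivial_iff] at hsub
    have hxTT' := K.inter_subset_convexHull hT hT' ⟨hxT, hxT'⟩
    rw [hsub.convex.convexHull_eq] at hxTT'
    exact hx (K.down_closed hT (Finset.singleton_subset_iff.2 hxTT'.1)
      (Finset.singleton_nonempty x))
  obtain ⟨k, hk, hTk⟩ := exists_isTriangle hT hspan hiT hjT hij
  obtain ⟨l, hl, hTl⟩ := exists_isTriangle hT' hspan' hiT' hjT' hij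
  refine ⟨i, j, k, l, ⟨hk, hl, ?_⟩, hTk, hTl⟩
  rintro rfl
  exact hne (Finset.coe_injective (hTk.trans hTl.symm))

lemma IsHinge.eqOn_add_smul (h : IsHinge K i j k l) (hf : Set.EqOn f s {i, j, k}) (hgi : g i = 0)
    (hgj : g j = 0) (hgl : g l = 1) :
    Set.EqOn (f + (2 * triangleArea i j l * hingeConductivity s i j k l) • g) s {i, j, l} := by
  have hi : f i = s i := hf (by simp)
  have hj : f j = s j := hf (by simp)
  have hk : f k = s k := hf (by simp)
  have hq : 2 * triangleArea i j l * hingeConductivity s i j k l = s l - f l := by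
    rw [h.hingeConductivity_eq_of_affineMap hi hj, hk, sub_self, zero_div, zero_add]
    exact mul_div_cancel₀ _ (mul_pos two_pos h.right.triangleArea_pos).ne'
  rintro v (rfl | rfl | rfl)
  · simp [hi, hgi]
  · simp [hj, hgj]
  · simp [hq, hgl]

lemma IsHinge.exists_affineMap_eqOn (h : IsHinge K i j k l) (hf : Set.EqOn f s {i, j, k})
    (hz : z ∈ convexHull ℝ {i, j, k} ∩ convexHull ℝ {i, j, l}) (hy : y ∈ segment ℝ z v)
    (hyl : y ∈ convexHull ℝ {i, j, l}) (hyk : y ∉ convexHull ℝ {i, j, k}) :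
    ∃ f' : Plane →ᵃ[ℝ] ℝ, Set.EqOn f' s {i, j, l} ∧
      ∃ c > 0, f' v = f v + c * hingeConductivity s i j k l := by
  obtain ⟨g, hgi, hgj, hgl⟩ := h.right.exists_affineMap 0 0 1
  have hg : ∀ u ∈ ({i, j} : Set Plane), g u = 0 := by simp [hgi, hgj]
  have hgz : g z = 0 := affineMap_eq_zero_of_mem_convexHull hg (h.inter_convexHull_subset hz)
  have hgy : 0 < g y := by
    refine affineMap_pos_of_notMem_convexHull (Set.insert_nonempty i {j}) hg (hgl ▸ one_pos) ?_
      fun hyij ↦ hyk (convexHull_mono (by grind) hyij)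
    convert hyl using 2
    grind
  have hgv : 0 < g v := by
    obtain ⟨c, d, -, hd, hcd, rfl⟩ := hy
    rw [Convex.combo_affine_apply hcd, hgz, smul_zero, zero_add] at hgy
    exact pos_of_mul_pos_right hgy hd
  refine ⟨_, h.eqOn_add_smul hf hgi hgj hgl, 2 * triangleArea i j l * g v,
    mul_pos (mul_pos two_pos h.right.triangleArea_pos) hgv, ?_⟩
  simp only [AffineMap.coe_add, AffineMap.coe_smul, Pi.add_apply, Pi.smul_apply, smul_eq_mul]
  ring

namespace IsTriangulation

lemma subset_of_mem_faces (hK : IsTriangulation V K) (ht : t ∈ K.faces) : t ⊆ V := fun v hv ↦ by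
  have hvK : v ∈ K.vertices :=
    K.down_closed ht (Finset.singleton_subset_iff.2 hv) (Finset.singleton_nonempty v)
  rwa [hK.vertices_eq] at hvK

lemma finite_faces (hK : IsTriangulation V K) : K.faces.Finite :=
  V.powerset.finite_toSet.subset fun _ ht ↦ Finset.mem_powerset.2 (hK.subset_of_mem_faces ht)

lemma convexHull_subset_closure (hK : IsTriangulation V K) (hV : ¬ Collinear ℝ (V : Set Plane)) :
    convexHull ℝ (V : Set Plane) ⊆ closure (interior K.space) := by
  rw [hK.space_eq, (convex_convexHull ℝ _).closure_interior_eq_closure_of_nonempty_interior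
    (interior_convexHull_nonempty_iff_affineSpan_eq_top.2 (affineSpan_eq_top_of_not_collinear hV))]
  exact subset_closure

lemma exists_superset (hK : IsTriangulation V K) (hV : ¬ Collinear ℝ (V : Set Plane))
    (ht : t ∈ K.faces) : ∃ T ∈ K.faces, affineSpan ℝ (T : Set Plane) = ⊤ ∧ t ⊆ T := by
  obtain ⟨a, x, ha, hpos⟩ := exists_isConvexCombination_pos (K.nonempty_of_mem_faces ht)
  obtain ⟨T, hT, hspan, hxT⟩ := exists_face_affineSpan_eq_top hK.finite_faces
    (hK.convexHull_subset_closure hV (ha.mono (hK.subset_of_mem_faces ht)).mem_convexHull)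
  exact ⟨T, hT, hspan, ha.subset_of_mem_convexHull hpos ht hT hxT⟩

/-- Where the segment from `z` to `v` leaves `T`, it enters a neighbouring triangle `T'`. -/
lemma exists_crossing (hK : IsTriangulation V K) (hV : ¬ Collinear ℝ (V : Set Plane))
    (hT : T ∈ K.faces) (hspan : affineSpan ℝ (T : Set Plane) = ⊤) (hf : Set.EqOn f s T)
    (hv : v ∈ V) (hz : z ∈ convexHull ℝ (T : Set Plane)) (hzV : z ∉ V)
    (hlast : ∀ y ∈ segment ℝ z v, y ∈ convexHull ℝ (T : Set Plane) → y = z) :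
    ∃ T' ∈ K.faces, affineSpan ℝ (T' : Set Plane) = ⊤ ∧
      (∃ y ∈ segment ℝ z v, y ≠ z ∧ y ∈ convexHull ℝ (T' : Set Plane)) ∧
      ∃ f' : Plane →ᵃ[ℝ] ℝ, Set.EqOn f' s T' ∧ ∃ c > 0, ∃ i j k l, IsHinge K i j k l ∧
        f' v = f v + c * hingeConductivity s i j k l := by
  have hzhull := convexHull_mono (Finset.coe_subset.2 (hK.subset_of_mem_faces hT)) hz
  have hsegment : segment ℝ z v ⊆ closure (interior K.space) :=
    ((convex_convexHull ℝ _).segment_subset hzhull (subset_convexHull ℝ _ hv)).trans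
      (hK.convexHull_subset_closure hV)
  obtain ⟨T', hT', hspan', hzT', y, hy, hyz, hyT'⟩ := exists_face_mem_segment hK.finite_faces
    (fun hzv : z = v ↦ hzV (hzv ▸ hv)) hsegment
  have hyT : y ∉ convexHull ℝ (T : Set Plane) := fun hyT ↦ hyz (hlast y hy hyT)
  obtain ⟨i, j, k, l, h, hTk, hTl⟩ := exists_isHinge hT hT' hspan hspan'
    (fun heq ↦ hyT (heq ▸ hyT')) hz hzT' (hK.vertices_eq ▸ hzV)
  refine ⟨T', hT', hspan', ⟨y, hy, hyz, hyT'⟩, ?_⟩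
  rw [hTk] at hf hz hyT
  rw [hTl] at hzT' hyT' ⊢
  obtain ⟨f', hf', c, hc, hfc⟩ := h.exists_affineMap_eqOn hf ⟨hz, hzT'⟩ hy hyT' hyT
  exact ⟨f', hf', c, hc, i, j, k, l, h, hfc⟩

lemma mem_of_mem_convexHull (hK : IsTriangulation V K) (hv : v ∈ V) (ht : t ∈ K.faces)
    (hvt : v ∈ convexHull ℝ (t : Set Plane)) : v ∈ t :=
  (Geometry.SimplicialComplex.vertex_mem_convexHull_iff (hK.vertices_eq ▸ hv) ht).1 hvt

/-- On the way from `T` to `v`, the value at `v` of the interpolating affine map never decreases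
when an edge is crossed, and it is `s v` on arrival. -/
lemma interpolation_le (hK : IsTriangulation V K) (hV : ¬ Collinear ℝ (V : Set Plane))
    (hQ : IsQAdapted s K) (hT : T ∈ K.faces) (hspan : affineSpan ℝ (T : Set Plane) = ⊤)
    (hf : Set.EqOn f s T) (hv : v ∈ V) : f v ≤ s v := by
  obtain ⟨x, hxT, hgeneric⟩ := exists_mem_convexHull_forall_segment hspan V v
  let F : Set (Finset Plane) := {t ∈ K.faces | affineSpan ℝ (t : Set Plane) = ⊤ ∧
    ∃ g : Plane →ᵃ[ℝ] ℝ, Set.EqOn g s t ∧ f v ≤ g v}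
  have hclosed : IsClosed (⋃ t ∈ F, convexHull ℝ (t : Set Plane)) :=
    (hK.finite_faces.subset (Set.sep_subset _ _)).isClosed_biUnion fun t _ ↦
      t.finite_toSet.isClosed_convexHull ℝ
  obtain ⟨z, hz, hzF, hlast⟩ := exists_mem_segment_forall_eq hclosed
    (Set.mem_biUnion (x := T) ⟨hT, hspan, f, hf, le_rfl⟩ hxT) v
  obtain ⟨t, ⟨ht, htspan, g, hg, hfg⟩, hzt⟩ := Set.mem_iUnion₂.1 hzF
  by_cases hzV : z ∈ V
  · obtain rfl := hgeneric z hz hzV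
    exact hfg.trans_eq (hg (hK.mem_of_mem_convexHull hv ht hzt))
  · obtain ⟨T', hT', hspan', ⟨y, hy, hyz, hyT'⟩, f', hf', c, hc, i, j, k, l, h, hfc⟩ :=
      hK.exists_crossing hV ht htspan hg hv hzt hzV fun y hy hyt ↦
        hlast y hy (Set.mem_biUnion (x := t) ⟨ht, htspan, g, hg, hfg⟩ hyt)
    have hle : f v ≤ f' v := by
      rw [hfc]
      exact hfg.trans (le_add_of_nonneg_right (mul_nonneg hc.le (hQ i j k l h)))
    exact absurd (hlast y hy (Set.mem_biUnion (x := T') ⟨hT', hspan', f', hf', hle⟩ hyT')) hyz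

lemma interpolation_lt (hK : IsTriangulation V K) (hV : ¬ Collinear ℝ (V : Set Plane))
    (hQ : IsQAdapted s K)
    (hne : ∀ i j k l, IsHinge K i j k l → hingeConductivity s i j k l ≠ 0) (hT : T ∈ K.faces)
    (hspan : affineSpan ℝ (T : Set Plane) = ⊤) (hf : Set.EqOn f s T) (hv : v ∈ V)
    (hvT : v ∉ T) : f v < s v := by
  obtain ⟨x, hxT, hgeneric⟩ := exists_mem_convexHull_forall_segment hspan V v
  obtain ⟨z, hz, hzT, hlast⟩ :=
    exists_mem_segment_forall_eq (T.finite_toSet.isClosed_convexHull ℝ) hxT v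
  have hzV : z ∉ V := by
    intro hzV
    obtain rfl := hgeneric z hz hzV
    exact hvT (hK.mem_of_mem_convexHull hv hT hzT)
  obtain ⟨T', hT', hspan', -, f', hf', c, hc, i, j, k, l, h, hfc⟩ :=
    hK.exists_crossing hV hT hspan hf hv hzT hzV hlast
  calc f v < f' v := by
        rw [hfc]
        exact lt_add_of_pos_right _ (mul_pos hc ((hQ i j k l h).lt_of_ne' (hne i j k l h)))
    _ ≤ s v := hK.interpolation_le hV hQ hT' hspan' hf' hv

lemma isLowerFace_of_isQAdapted (hK : IsTriangulation V K) (hV : ¬ Collinear ℝ (V : Set Plane))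
    (hQ : IsQAdapted s K) (ht : t ∈ K.faces) : IsLowerFace s V t := by
  obtain ⟨T, hT, hspan, htT⟩ := hK.exists_superset hV ht
  obtain ⟨f, hf⟩ := exists_affineMap_eq (K.indep hT) s
  exact (IsLowerFace.of_affineMap_le (hK.subset_of_mem_faces hT) f
    (fun v hv ↦ hK.interpolation_le hV hQ hT hspan hf hv) hf).mono htT

theorem eq_of_isQAdapted (hK : IsTriangulation V K) (hV : ¬ Collinear ℝ (V : Set Plane))
    (hQ : IsQAdapted s K) (hne : ∀ i j k l, IsHinge K i j k l → hingeConductivity s i j k l ≠ 0)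
    (hK' : IsTriangulation V K') (hQ' : IsQAdapted s K') : K' = K := by
  refine eq_of_faces_subset (fun t ht ↦ ?_) (hK.space_eq.trans hK'.space_eq.symm).subset
  obtain ⟨a, x, ha, hpos⟩ := exists_isConvexCombination_pos (K'.nonempty_of_mem_faces ht)
  obtain ⟨T, hT, hspan, hxT⟩ := exists_face_affineSpan_eq_top hK.finite_faces
    (hK.convexHull_subset_closure hV (ha.mono (hK'.subset_of_mem_faces ht)).mem_convexHull)
  obtain ⟨f, hf⟩ := exists_affineMap_eq (K.indep hT) s
  refine K.down_closed hT ?_ (K'.nonempty_of_mem_faces ht)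
  exact (hK'.isLowerFace_of_isQAdapted hV hQ' ht).subset_of_affineMap_lt
    (hK.subset_of_mem_faces hT) hf (fun v ↦ hK.interpolation_lt hV hQ hne hT hspan hf) ha hpos hxT

end IsTriangulation

lemma isQAdapted_of_isLowerFace (hfaces : ∀ t ∈ K.faces, IsLowerFace s V t) : IsQAdapted s K := by
  classical
  intro i j k l h
  have hij : IsLowerFace s V {i, j} := (hfaces _ h.left.mem_faces).mono (by grind)
  have hsub : ({i, j, k, l} : Finset Plane) ⊆ V := by
    have hk := (hfaces _ h.left.mem_faces).subset
    have hl := (hfaces _ h.right.mem_faces).subset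
    simp only [Finset.insert_subset_iff, Finset.singleton_subset_iff] at hk hl ⊢
    exact ⟨hk.1, hk.2.1, hk.2.2, hl.2.2⟩
  have hμ := h.isAffineDependence_hingeWeight
  have hnonneg : ∀ v ∉ ({i, j} : Finset Plane), 0 ≤ hingeWeight i j k l v := by
    intro v hv
    have hk := h.left.triangleArea_pos
    have hl := h.right.triangleArea_pos
    simp only [Finset.mem_insert, Finset.mem_singleton, not_or] at hv
    simp only [hingeWeight, Pi.add_apply, Pi.single_apply, hv.1, hv.2, if_false, zero_add]
    split_ifs <;> positivity
  rw [h.hingeConductivity_eq_sum, ← hμ.sum_mul_eq_of_subset hsub]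
  exact hij.sum_nonneg _ (hμ.mono hsub) hnonneg

lemma IsLowerHullProjection.isLowerFace (hK : IsLowerHullProjection s V K) (ht : t ∈ K.faces) :
    IsLowerFace s V t := by
  have htV : t ⊆ V := fun v hv ↦ hK.vertices_subset
    (K.down_closed ht (Finset.singleton_subset_iff.2 hv) (Finset.singleton_nonempty v))
  refine .of_convexHull_lift_subset htV (K.nonempty_of_mem_faces ht) ?_
  rw [← hK.lift_eq]
  exact Set.subset_biUnion_of_mem (u := fun t : Finset Plane ↦ convexHull ℝ (lift s '' t)) ht

lemma IsLowerHullProjection.isQAdapted (hK : IsLowerHullProjection s V K) : IsQAdapted s K :=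
  isQAdapted_of_isLowerFace fun _ ↦ hK.isLowerFace

theorem exists_isTriangulation_isLowerHullProjection_iff :
    (∃ K, IsTriangulation V K ∧ IsLowerHullProjection s V K) ↔
      ∀ v ∈ V, lift s v ∈ lowerHull s V := by
  constructor
  · rintro ⟨K, hK, hproj⟩ v hv
    exact (lift_mem_lowerHull_iff hv).2 (hproj.isLowerFace (hK.vertices_eq ▸ hv : v ∈ K.vertices))
  · intro hs
    obtain ⟨K, hvertices, hspace, hfaces⟩ := exists_complex_forall_isLowerFace fun v hv ↦
      (lift_mem_lowerHull_iff hv).1 (hs v hv)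
    have hK : IsTriangulation V K := ⟨hvertices, hspace⟩
    exact ⟨K, hK, hK.isLowerHullProjection hfaces⟩

end Triangulations

end QAdapted

theorem mainTheorem7_general (V : Finset QAdapted.Plane) (s : QAdapted.Plane → ℝ) :
    ((∃ K : QAdapted.PlaneComplex,
      QAdapted.IsTriangulation V K ∧ QAdapted.IsLowerHullProjection s V K ∧
        QAdapted.IsQAdapted s K) ↔
      ∀ v ∈ V, QAdapted.lift s v ∈ QAdapted.lowerHull s V) ∧
    (∀ K : QAdapted.PlaneComplex,
      QAdapted.IsLowerHullProjection s V K → QAdapted.IsQAdapted s K) ∧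
    (∀ (K : QAdapted.PlaneComplex) (i j k l : QAdapted.Plane), QAdapted.IsHinge K i j k l →
      (0 < QAdapted.hingeConductivity s i j k l ↔ QAdapted.HingeConvex s i j k l) ∧
      (QAdapted.hingeConductivity s i j k l = 0 ↔ QAdapted.HingeFlat s i j k l)) ∧
    (¬ Collinear ℝ (V : Set QAdapted.Plane) → ∀ K : QAdapted.PlaneComplex,
      QAdapted.IsTriangulation V K → QAdapted.IsQAdapted s K →
      (∀ i j k l : QAdapted.Plane, QAdapted.IsHinge K i j k l →
        QAdapted.hingeConductivity s i j k l ≠ 0) →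
      ∀ K' : QAdapted.PlaneComplex,
        QAdapted.IsTriangulation V K' → QAdapted.IsQAdapted s K' → K' = K) := by
  refine ⟨⟨?_, fun hs ↦ ?_⟩, fun K hK ↦ hK.isQAdapted,
    fun K i j k l h ↦ ⟨h.hingeConductivity_pos_iff, h.hingeConductivity_eq_zero_iff⟩,
    fun hV K hK hQ hne K' hK' hQ' ↦ hK.eq_of_isQAdapted hV hQ hne hK' hQ'⟩
  · rintro ⟨K, hK, hproj, -⟩
    exact QAdapted.exists_isTriangulation_isLowerHullProjection_iff.1 ⟨K, hK, hproj⟩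
  · obtain ⟨K, hK, hproj⟩ := QAdapted.exists_isTriangulation_isLowerHullProjection_iff.2 hs
    exact ⟨K, hK, hproj, hproj.isQAdapted⟩

theorem mainTheorem7 (V : Finset QAdapted.Plane)
    (hV : ¬ Collinear ℝ (V : Set QAdapted.Plane))
    (s : QAdapted.Plane → ℝ)
    (hs : ConvexOn ℝ (convexHull ℝ (V : Set QAdapted.Plane)) s) :
    (∃ K : QAdapted.PlaneComplex,
      QAdapted.IsTriangulation V K ∧ QAdapted.IsLowerHullProjection s V K ∧
        QAdapted.IsQAdapted s K) ∧
    (∀ K : QAdapted.PlaneComplex,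
      QAdapted.IsLowerHullProjection s V K → QAdapted.IsQAdapted s K) ∧
    (∀ (K : QAdapted.PlaneComplex) (i j k l : QAdapted.Plane), QAdapted.IsHinge K i j k l →
      (0 < QAdapted.hingeConductivity s i j k l ↔ QAdapted.HingeConvex s i j k l) ∧
      (QAdapted.hingeConductivity s i j k l = 0 ↔ QAdapted.HingeFlat s i j k l)) ∧
    (∀ K : QAdapted.PlaneComplex,
      QAdapted.IsTriangulation V K → QAdapted.IsQAdapted s K →
      (∀ i j k l : QAdapted.Plane, QAdapted.IsHinge K i j k l →
        QAdapted.hingeConductivity s i j k l ≠ 0) →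
      ∀ K' : QAdapted.PlaneComplex,
        QAdapted.IsTriangulation V K' → QAdapted.IsQAdapted s K' → K' = K) := by
  obtain ⟨hexists, hproj, hhinge, hunique⟩ := mainTheorem7_general V s
  exact ⟨hexists.2 fun v hv ↦ QAdapted.lift_mem_lowerHull_of_convexOn hs hv, hproj, hhinge,
    hunique hV⟩
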